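/- Let $\mathbb{F}_q$ be a finite field with $q$ elements, and for each $n\in\mathbb{N}$ let $f_n$ be a random polynomial chosen uniformly among the $q^n$ monic polynomials of degree $n$ in $\mathbb{F}_q[X]$. Let $D_n$ be the number of distinct monic irreducible divisors of $f_n$ (counted without multiplicity), and let $\mathrm{Irr}(\mathbb{F}_q)$ be the set of monic irreducible polynomials in $\mathbb{F}_q[X]$. Put $$R_q=\sum_{k=2}^\infty \frac{\mu(k)}{k}\log\Big(\frac{1}{1-q^{1-k}}\Big),\qquad \lambda_n=\log n+R_q+\gamma,$$ where $\mu$ is the Möbius function and $\gamma$ is the Euler--Mascheroni constant, and let $A_q$ be the family of real numbers $$A_q=\Big\{1,\tfrac12,\tfrac13,\ldots\Big\}\sqcup\Big\{\frac{1}{q^{\deg P}},\ P\in\mathrm{Irr}(\mathbb{F}_q)\Big\}$$ (disjoint union of families, with repetitions). For a square-summable family $A=(a_i)_i$ of real numbers and $z\in\mathbb{C}$ write $\mathfrak{E}(A',z)=\prod_{i}(1+a_iz)\,\mathrm{e}^{-a_iz}$. Then the sequence $(D_n)_n$ converges mod-Poisson with parameters $(\lambda_n)_n$ and Bernoulli asymptotics,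 with limiting alphabet $A_q$; that is, $A_q$ is square-summable, and there is $r>1$ such that $$\mathbb{E}[w^{D_n}]\,\mathrm{e}^{-\lambda_n(w-1)}\ \longrightarrow\ \mathfrak{E}(A_q',w-1)\qquad(n\to\infty)$$ locally uniformly on the disc $\{w\in\mathbb{C} : |w|<r\}$. Moreover, the convergence happens locally uniformly on the disc $\{w\in\mathbb{C} : |w|<q\}$ at speed $O(n^{-1})$: for every compact subset $K$ of this disc there is a constant $C$ such that, for all $n\geq 1$ and all $w\in K$, $$\Big|\mathbb{E}[w^{D_n}]\,\mathrm{e}^{-(\log n+R_q+\gamma)(w-1)}-\mathfrak{E}(A_q',w-1)\Big|\leq \frac{C}{n}.$$ -/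

import Mathlib

open MeasureTheory ProbabilityTheory Filter Topology Polynomial

noncomputable section

/-- The function `z ↦ 𝔈(A', z) = ∏_i (1 + a_i z) exp (-a_i z)` attached to a (square-summable)
family `A = (a_i)` of real numbers. -/
def bernoulliResidue {ι : Type*} (A : ι → ℝ) (z : ℂ) : ℂ :=
  ∏' i, (1 + (A i : ℂ) * z) * Complex.exp (-((A i : ℂ) * z))

/-- For a square-summable family the product defining `bernoulliResidue A z` converges. -/
theorem multipliable_bernoulliResidue {ι : Type*} {A : ι → ℝ}
    (hA : Summable fun i => A i ^ 2) (z : ℂ) :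
    Multipliable fun i => (1 + (A i : ℂ) * z) * Complex.exp (-((A i : ℂ) * z)) := by
  have key : ∀ u : ℂ, ‖u‖ ≤ 1 → ‖(1 + u) * Complex.exp (-u) - 1‖ ≤ 3 * ‖u‖ ^ 2 := by
    intro u hu
    have h := Complex.norm_exp_sub_one_sub_id_le (x := -u) (by simpa using hu)
    have e : (1 + u) * Complex.exp (-u) - 1
        = (1 + u) * (Complex.exp (-u) - 1 - (-u)) - u ^ 2 := by ring
    have h1 : ‖1 + u‖ ≤ 2 := by
      calc ‖1 + u‖ ≤ ‖(1 : ℂ)‖ + ‖u‖ := norm_add_le _ _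
        _ ≤ 2 := by rw [norm_one]; linarith
    rw [norm_neg] at h
    calc ‖(1 + u) * Complex.exp (-u) - 1‖
        ≤ ‖(1 + u) * (Complex.exp (-u) - 1 - (-u))‖ + ‖u ^ 2‖ := by rw [e]; exact norm_sub_le _ _
      _ ≤ 2 * ‖u‖ ^ 2 + ‖u‖ ^ 2 := by
          rw [norm_mul, norm_pow]
          gcongr
      _ = 3 * ‖u‖ ^ 2 := by ring
  have hs : Summable fun i => ‖(A i : ℂ) * z‖ ^ 2 := by
    simpa [mul_pow] using hA.mul_right (‖z‖ ^ 2)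
  have hsm : ∀ᶠ i in cofinite, ‖(A i : ℂ) * z‖ ≤ 1 := by
    filter_upwards [hs.tendsto_cofinite_zero.eventually (ge_mem_nhds zero_lt_one)] with i hi
    exact (sq_le_one_iff₀ (norm_nonneg _)).1 hi
  have hn : Summable fun i => ‖(1 + (A i : ℂ) * z) * Complex.exp (-((A i : ℂ) * z)) - 1‖ := by
    refine Summable.of_norm_bounded_eventually (hs.mul_left 3) ?_
    filter_upwards [hsm] with i hi
    simpa using key _ hi
  simpa using multipliable_one_add_of_summable hn

/-- The sequence of `ℕ`-valued random variables `X n`, each on its own probability space, converges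
mod-Poisson with parameters `lam n` and with Bernoulli asymptotics, the limiting alphabet being the
square-summable family `A`: on some disc `{|w| < r}` with `r > 1`, locally uniformly in `w`,
`𝔼[w ^ (X n)] * exp (-(lam n) (w - 1)) → 𝔈(A', w - 1)`. -/
structure ConvergesModPoissonBernoulli {Ω : ℕ → Type*} [∀ n, MeasurableSpace (Ω n)]
    (P : ∀ n, Measure (Ω n)) (X : ∀ n, Ω n → ℕ) (lam : ℕ → ℝ) {ι : Type*} (A : ι → ℝ) :
    Prop where
  aemeasurable : ∀ n, AEMeasurable (X n) (P n)
  summable_sq : Summable fun i => A i ^ 2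
  tendsto : ∃ r : ℝ, 1 < r ∧
    (∀ n, ∀ w ∈ Metric.ball (0 : ℂ) r, Integrable (fun ω => w ^ X n ω) (P n)) ∧
    TendstoLocallyUniformlyOn
      (fun n (w : ℂ) => (∫ ω, w ^ X n ω ∂(P n)) * Complex.exp (-((lam n : ℂ) * (w - 1))))
      (fun w => bernoulliResidue A (w - 1)) atTop (Metric.ball 0 r)

/-- The number of distinct monic irreducible divisors of `f` (meant for `f ≠ 0`). -/
def numIrreducibleDivisors {F : Type*} [Field F] (f : F[X]) : ℕ :=
  {Q : F[X] | Q.Monic ∧ Irreducible Q ∧ Q ∣ f}.ncard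

/-- `R_q = ∑_{k ≥ 2} (μ(k) / k) log (1 / (1 - q^(1-k)))`; the index `j` stands for `k = j + 2`. -/
def polyR (q : ℕ) : ℝ :=
  ∑' j : ℕ, (ArithmeticFunction.moebius (j + 2) : ℝ) / ((j + 2 : ℕ) : ℝ) *
    Real.log (1 / (1 - (q : ℝ) ^ (1 - ((j + 2 : ℕ) : ℤ))))

/-- The series defining `polyR q` converges absolutely as soon as `q ≥ 2`. -/
theorem summable_polyR {q : ℕ} (hq : 2 ≤ q) :
    Summable fun j : ℕ => (ArithmeticFunction.moebius (j + 2) : ℝ) / ((j + 2 : ℕ) : ℝ) *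
      Real.log (1 / (1 - (q : ℝ) ^ (1 - ((j + 2 : ℕ) : ℤ)))) := by
  have hq' : (2 : ℝ) ≤ q := by exact_mod_cast hq
  have hx0 : (0 : ℝ) < (q : ℝ)⁻¹ := by positivity
  have hx1 : (q : ℝ)⁻¹ ≤ 1 / 2 := by
    rw [one_div]; exact inv_anti₀ two_pos hq'
  have hg : Summable fun j : ℕ => 2 * ((q : ℝ)⁻¹) ^ j :=
    (summable_geometric_of_lt_one hx0.le (by linarith)).mul_left 2
  refine Summable.of_norm_bounded hg fun j => ?_
  have e : (q : ℝ) ^ (1 - ((j + 2 : ℕ) : ℤ)) = ((q : ℝ)⁻¹) ^ (j + 1) := by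
    have : (1 - ((j + 2 : ℕ) : ℤ)) = -((j + 1 : ℕ) : ℤ) := by push_cast; ring
    rw [this, zpow_neg, zpow_natCast, inv_pow]
  rw [e]
  set t : ℝ := ((q : ℝ)⁻¹) ^ (j + 1) with ht
  have ht0 : 0 < t := by positivity
  have htj : t ≤ 1 / 2 * ((q : ℝ)⁻¹) ^ j := by
    rw [ht, pow_succ, mul_comm]
    gcongr
  have hj1 : ((q : ℝ)⁻¹) ^ j ≤ 1 := pow_le_one₀ hx0.le (by linarith)
  have ht1 : t ≤ 1 / 2 := by linarith
  have hpos : 0 < 1 - t := by linarith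
  have hl0 : 0 ≤ Real.log (1 / (1 - t)) :=
    Real.log_nonneg (by rw [le_div_iff₀ hpos]; linarith)
  have hl1 : Real.log (1 / (1 - t)) ≤ 2 * t := by
    refine (Real.log_le_sub_one_of_pos (by positivity)).trans ?_
    rw [sub_le_iff_le_add, div_le_iff₀ hpos]
    nlinarith
  have hm : |(ArithmeticFunction.moebius (j + 2) : ℝ)| ≤ 1 := by
    exact_mod_cast ArithmeticFunction.abs_moebius_le_one (n := j + 2)
  have hd : ‖(ArithmeticFunction.moebius (j + 2) : ℝ) / ((j + 2 : ℕ) : ℝ)‖ ≤ 1 := by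
    rw [Real.norm_eq_abs, abs_div, Nat.abs_cast]
    refine div_le_one_of_le₀ (hm.trans ?_) (by positivity)
    push_cast
    have : (0 : ℝ) ≤ j := by positivity
    linarith
  rw [norm_mul, Real.norm_of_nonneg hl0]
  calc _ ≤ 1 * Real.log (1 / (1 - t)) := by gcongr
    _ ≤ 2 * ((q : ℝ)⁻¹) ^ j := by
        have : 0 < ((q : ℝ)⁻¹) ^ j := by positivity
        linarith

/-- The parameters `λ_n = log n + R_q + γ`. -/
def polyParam (q n : ℕ) : ℝ :=
  Real.log n + polyR q + Real.eulerMascheroniConstant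

/-- The alphabet `{1, 1/2, 1/3, …} ⊔ {q^(-deg Q) : Q monic irreducible over F}`, `q = |F|`, as a
family indexed by the disjoint union of the two index sets. -/
def polyAlphabet (F : Type*) [Field F] [Fintype F] :
    ℕ ⊕ {Q : F[X] // Q.Monic ∧ Irreducible Q} → ℝ :=
  Sum.elim (fun k => 1 / ((k : ℝ) + 1))
    (fun Q => 1 / (Fintype.card F : ℝ) ^ (Q : F[X]).natDegree)

end

/-! Put `z = w - 1`. Expanding `(1 + z) ^ D(f)` over sets of irreducible divisors of `f`, and
counting the multiples of a monic polynomial of given degree, shows that `𝔼[w ^ D_n]` is the sum of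
the coefficients of index at most `n` of the Euler product `∏ (1 + z (u/q) ^ deg Q)`
(`sum_pow_numIrreducibleDivisors`, `hasSum_sqfreeCoeff`).

By the prime polynomial theorem, `N_d / q^d` is `1/d` up to an exponentially small defect. The main
terms `1/d` produce the singular factor `(1 - u) ^ (-z)`. What remains, `analyticFactor`, is
holomorphic on a disc of radius greater than 1, so its Taylor coefficients decay geometrically
(`tprod_one_add_eq_analyticFactor_mul`, `exists_taylor_bound`). Taking partial sums multiplies by `1
/ (1 - u)`; hence `𝔼[w ^ D_n]` is a convolution of these coefficients with those of `(1 - u) ^ (-(z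
+ 1))`, which are `∏_{j ≤ n} (1 + z/j) = n^z (1 / Γ(1 + z) + O(1/n))` (`exists_risingCoeff_bounds`).
The geometric decay transfers this asymptotic to the convolution, with limit `analyticFactor` at `u
= 1` times `1 / Γ(1 + z)` (`exists_convolution_rate`).

Finally `analyticFactor` at `u = 1` is the product over irreducibles times `exp (z R_q)`, because
the defects sum to `R_q` by Möbius inversion (`hasSum_irrDefect`), while `1 / Γ(1 + z)` is the
product over the integers times `exp (z γ)`. The parameter `λ_n` removes both exponentials and
leaves the residue of the alphabet. All constants are uniform for `z` in any bounded set. -/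

/-! ### Elementary factors and infinite products. -/

/-- The elementary factor `(1 + u) exp (-u)`. -/
noncomputable def bernoulliFactor (u : ℂ) : ℂ := (1 + u) * Complex.exp (-u)

/-- The linear terms of the two factors cancel, leaving a quadratic error. The radius is arbitrary
because `z` will range over discs of any size. -/
theorem norm_bernoulliFactor_sub_one_le {R : ℝ} {u : ℂ} (hu : ‖u‖ ≤ R) :
    ‖bernoulliFactor u - 1‖ ≤ ((1 + R) * Real.exp R + 1) * ‖u‖ ^ 2 := by
  have h := Complex.norm_exp_sub_sum_le_norm_mul_exp (-u) 2
  have e : bernoulliFactor u - 1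
      = (1 + u) * (Complex.exp (-u) - ∑ m ∈ Finset.range 2, (-u) ^ m / (m.factorial : ℂ))
        - u ^ 2 := by
    simp [bernoulliFactor, Finset.sum_range_succ]; ring
  rw [norm_neg] at h
  have hR : 0 ≤ R := (norm_nonneg _).trans hu
  have h1 : ‖1 + u‖ ≤ 1 + R := (norm_add_le _ _).trans (by rw [norm_one]; linarith)
  calc ‖bernoulliFactor u - 1‖
      ≤ ‖1 + u‖ * ‖Complex.exp (-u) - ∑ m ∈ Finset.range 2, (-u) ^ m / (m.factorial : ℂ)‖
          + ‖u‖ ^ 2 := by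
        rw [e, ← norm_mul, ← norm_pow]; exact norm_sub_le _ _
    _ ≤ (1 + R) * (‖u‖ ^ 2 * Real.exp R) + ‖u‖ ^ 2 := by
        gcongr
        exact h.trans (by gcongr)
    _ = _ := by ring

theorem differentiable_bernoulliFactor : Differentiable ℂ bernoulliFactor := by
  unfold bernoulliFactor; fun_prop

theorem bernoulliResidue_eq_tprod {ι : Type*} (A : ι → ℝ) (z : ℂ) :
    bernoulliResidue A z = ∏' i, bernoulliFactor ((A i : ℂ) * z) := rfl

theorem norm_tprod_one_add_sub_one_le {ι : Type*} {f : ι → ℂ} (hf : Summable fun i => ‖f i‖) :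
    ‖∏' i, (1 + f i) - 1‖ ≤ Real.exp (∑' i, ‖f i‖) - 1 := by
  have h := (multipliable_one_add_of_summable hf).hasProd
  refine le_of_tendsto ((h.sub_const 1).norm) (Eventually.of_forall fun s => ?_)
  refine (Finset.norm_prod_one_add_sub_one_le s f).trans ?_
  gcongr
  exact hf.sum_le_tsum s fun i _ => norm_nonneg _

theorem norm_tprod_one_add_le {ι : Type*} {f : ι → ℂ} (hf : Summable fun i => ‖f i‖) :
    ‖∏' i, (1 + f i)‖ ≤ Real.exp (∑' i, ‖f i‖) := by
  have h := norm_tprod_one_add_sub_one_le hf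
  have h2 : ‖∏' i, (1 + f i)‖ ≤ ‖∏' i, (1 + f i) - 1‖ + ‖(1 : ℂ)‖ := by
    simpa using norm_add_le (∏' i, (1 + f i) - 1) 1
  rw [norm_one] at h2
  linarith

/-- Expanding the product over finite subsets of the index set gives a normally convergent series of
holomorphic functions. -/
theorem differentiableOn_tprod_one_add {ι : Type*} {f : ι → ℂ → ℂ} {U : Set ℂ} (hU : IsOpen U)
    {b : ι → ℝ} (hb : Summable b) (hf : ∀ i, DifferentiableOn ℂ (f i) U)
    (hfb : ∀ i, ∀ u ∈ U, ‖f i u‖ ≤ b i) :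
    DifferentiableOn ℂ (fun u => ∏' i, (1 + f i u)) U := by
  classical
  rcases U.eq_empty_or_nonempty with rfl | ⟨u₀, hu₀⟩
  · exact differentiableOn_empty
  have hb0 : ∀ i, 0 ≤ b i := fun i => (norm_nonneg _).trans (hfb i u₀ hu₀)
  have key : DifferentiableOn ℂ (fun u => ∑' s : Finset ι, ∏ i ∈ s, f i u) U := by
    refine Complex.differentiableOn_tsum_of_summable_norm
      (summable_finsetProd_of_summable_nonneg hb0 hb) (fun s => ?_) hU fun s u hu => ?_
    · exact DifferentiableOn.fun_finsetProd fun i _ => hf i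
    · rw [norm_prod]
      exact Finset.prod_le_prod (fun i _ => norm_nonneg _) fun i _ => hfb i u hu
  refine key.congr fun u hu => ?_
  exact tprod_one_add (summable_finsetProd_of_summable_norm
    (Summable.of_nonneg_of_le (fun i => norm_nonneg _) (fun i => hfb i u hu) hb))

/-! ### Power series: uniqueness, Cauchy products, Cauchy estimates. -/

theorem hasFPowerSeriesOnBall_of_hasSum {a : ℕ → ℂ} {F : ℂ → ℂ}
    (ha : ∀ u : ℂ, ‖u‖ < 1 → HasSum (fun k => a k * u ^ k) (F u)) :
    HasFPowerSeriesOnBall F (FormalMultilinearSeries.ofScalars ℂ a) 0 1 where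
  r_le := by
    refine ENNReal.le_of_forall_nnreal_lt fun r hr => ?_
    have hr1 : (r : ℝ) < 1 := by exact_mod_cast hr
    refine FormalMultilinearSeries.le_radius_of_summable_norm _ ?_
    have h := (ha (r : ℝ) (by simpa using hr1)).summable.norm
    refine h.congr fun k => ?_
    simp
  r_pos := one_pos
  hasSum := by
    intro y hy
    have hy' : ‖y‖ < 1 := by
      rw [← ENNReal.ofReal_one, Metric.eball_ofReal] at hy
      simpa using hy
    simpa [FormalMultilinearSeries.ofScalars_apply_eq, smul_eq_mul, mul_comm] using ha y hy'

theorem coeff_eq_of_hasSum_ball {a b : ℕ → ℂ} {F : ℂ → ℂ}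
    (ha : ∀ u : ℂ, ‖u‖ < 1 → HasSum (fun k => a k * u ^ k) (F u))
    (hb : ∀ u : ℂ, ‖u‖ < 1 → HasSum (fun k => b k * u ^ k) (F u)) : a = b := by
  have h := (hasFPowerSeriesOnBall_of_hasSum ha).hasFPowerSeriesAt.eq_formalMultilinearSeries
    (hasFPowerSeriesOnBall_of_hasSum hb).hasFPowerSeriesAt
  exact (FormalMultilinearSeries.ofScalars_series_eq_iff ℂ a b).1 h

theorem hasSum_ball_mul {a b : ℕ → ℂ} {F G : ℂ → ℂ}
    (ha : ∀ u : ℂ, ‖u‖ < 1 → HasSum (fun k => a k * u ^ k) (F u))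
    (hb : ∀ u : ℂ, ‖u‖ < 1 → HasSum (fun k => b k * u ^ k) (G u)) {u : ℂ} (hu : ‖u‖ < 1) :
    HasSum (fun n => (∑ k ∈ Finset.range (n + 1), a k * b (n - k)) * u ^ n) (F u * G u) := by
  have h := hasSum_sum_range_mul_of_summable_norm (ha u hu).summable.norm (hb u hu).summable.norm
  rw [(ha u hu).tsum_eq, (hb u hu).tsum_eq] at h
  refine h.congr_fun fun n => ?_ 
  rw [Finset.sum_mul]
  refine Finset.sum_congr rfl fun k hk => ?_
  have hk : k ≤ n := Nat.lt_succ_iff.1 (Finset.mem_range.1 hk)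
  conv_lhs => rw [← Nat.add_sub_of_le hk, pow_add]
  simp; ring

theorem exists_taylor_bound {F : ℂ → ℂ} {ρ M : ℝ} (hρ : 0 < ρ)
    (hF : DifferentiableOn ℂ F (Metric.closedBall 0 ρ))
    (hM : ∀ u ∈ Metric.closedBall (0 : ℂ) ρ, ‖F u‖ ≤ M) :
    ∃ h : ℕ → ℂ, (∀ u : ℂ, ‖u‖ < ρ → HasSum (fun k => h k * u ^ k) (F u)) ∧
      ∀ k, ‖h k‖ ≤ M * ρ⁻¹ ^ k := by
  lift ρ to NNReal using hρ.le
  have hp := hF.hasFPowerSeriesOnBall (by exact_mod_cast hρ)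
  refine ⟨fun k => (cauchyPowerSeries F 0 ρ).coeff k, fun u hu => ?_, fun k => ?_⟩
  · have := hp.hasSum (y := u) (by simpa [Metric.mem_eball, edist_zero_right, enorm_lt_coe] using hu)
    simpa [FormalMultilinearSeries.apply_eq_pow_smul_coeff, mul_comm] using this
  · rw [← FormalMultilinearSeries.norm_apply_eq_norm_coef]
    refine (norm_cauchyPowerSeries_le F 0 ρ k).trans ?_
    rw [abs_of_pos hρ]
    gcongr
    have : ∫ θ in (0 : ℝ)..2 * Real.pi, ‖F (circleMap 0 ρ θ)‖ ≤ M * (2 * Real.pi) := by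
      have h := intervalIntegral.norm_integral_le_of_norm_le_const (a := 0) (b := 2 * Real.pi)
        (f := fun θ => ‖F (circleMap 0 ρ θ)‖) (C := M) (fun θ _ => by
          rw [norm_norm]
          exact hM _ (Metric.sphere_subset_closedBall (circleMap_mem_sphere 0 hρ.le θ)))
      rw [sub_zero, abs_of_pos Real.two_pi_pos] at h
      exact (le_abs_self _).trans h
    calc _ ≤ (2 * Real.pi)⁻¹ * (M * (2 * Real.pi)) := by gcongr
      _ = M := by field_simp

/-! ### Coefficients of `(1 - u) ^ (-(z + 1))` and their asymptotics. -/

/-- The coefficient `∏_{1 ≤ j ≤ n} (1 + z / j)` of `u ^ n` in `(1 - u) ^ (-(z + 1))`. -/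
noncomputable def risingCoeff (z : ℂ) (n : ℕ) : ℂ := ∏ j ∈ Finset.range n, (1 + z / (j + 1))

theorem risingCoeff_zero (z : ℂ) : risingCoeff z 0 = 1 := by simp [risingCoeff]

theorem risingCoeff_succ (z : ℂ) (n : ℕ) :
    risingCoeff z (n + 1) = risingCoeff z n * (1 + z / (n + 1)) := Finset.prod_range_succ _ _

/-- Together with `risingCoeff_succ`, this expresses `(1 - u) * (1 - u) ^ (-(z + 1)) = (1 - u) ^
(-z)` on coefficients. -/
theorem risingCoeff_sub_one_succ (z : ℂ) (n : ℕ) :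
    risingCoeff (z - 1) (n + 1) = risingCoeff z n * (z / (n + 1)) := by
  induction n with
  | zero => simp [risingCoeff]
  | succ n ih =>
    rw [risingCoeff_succ, ih, risingCoeff_succ]
    have h1 : (n : ℂ) + 1 ≠ 0 := by exact_mod_cast n.succ_ne_zero
    have h2 : (n : ℂ) + 1 + 1 ≠ 0 := by exact_mod_cast (n + 1).succ_ne_zero
    push_cast
    field_simp
    ring

theorem ringChoose_eq_risingCoeff (z : ℂ) (n : ℕ) :
    Ring.choose (z + n - 1) n = risingCoeff (z - 1) n := by
  have h : Ring.choose (z + n - 1) n = Ring.multichoose z n := by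
    rw [Ring.choose]; congr 1; ring
  have h2 := Ring.factorial_nsmul_multichoose_eq_ascPochhammer z n
  rw [h]
  have key : ∀ m : ℕ, (ascPochhammer ℕ m).smeval z = (m.factorial : ℂ) * risingCoeff (z - 1) m := by
    intro m
    induction m with
    | zero => simp [risingCoeff]
    | succ m ih =>
      have hm : (m : ℂ) + 1 ≠ 0 := by exact_mod_cast m.succ_ne_zero
      rw [ascPochhammer_succ_right, Polynomial.smeval_mul, ih, risingCoeff_succ]
      simp [Polynomial.smeval_add, Polynomial.smeval_natCast, Nat.factorial_succ]
      field_simp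
      ring
  rw [key, nsmul_eq_mul] at h2
  exact mul_left_cancel₀ (by exact_mod_cast n.factorial_ne_zero) h2

theorem hasSum_risingCoeff (z : ℂ) {u : ℂ} (hu : ‖u‖ < 1) :
    HasSum (fun k => risingCoeff (z - 1) k * u ^ k) (Complex.exp (-(z * Complex.log (1 - u)))) := by
  have h := (Complex.one_div_one_sub_cpow_hasFPowerSeriesOnBall_zero z).hasSum (y := u) (by
    rw [← ENNReal.ofReal_one, Metric.eball_ofReal]; simpa using hu)
  have h0 : (1 : ℂ) - u ≠ 0 := by
    intro h
    rw [sub_eq_zero] at h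
    rw [← h] at hu
    simp at hu
  simp only [FormalMultilinearSeries.ofScalars_apply_eq, smul_eq_mul, ringChoose_eq_risingCoeff,
    zero_add, Complex.cpow_def_of_ne_zero h0, one_div, ← Complex.exp_neg] at h
  simpa [mul_comm z] using h

/-- Telescoping: each term is at most `1 / (n + m) - 1 / (n + m + 1)`. -/
theorem sum_inv_sq_shift_le {n : ℕ} (hn : 1 ≤ n) (m : ℕ) :
    ∑ j ∈ Finset.range m, 1 / ((j : ℝ) + n + 1) ^ 2 ≤ 1 / n - 1 / ((n : ℝ) + m) := by
  have hn' : (1 : ℝ) ≤ n := by exact_mod_cast hn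
  induction m with
  | zero => simp
  | succ m ih =>
    rw [Finset.sum_range_succ]
    have hm : (0 : ℝ) ≤ m := by positivity
    have : 1 / ((m : ℝ) + n + 1) ^ 2 ≤ 1 / ((n : ℝ) + m) - 1 / ((n : ℝ) + (m + 1 : ℕ)) := by
      push_cast
      rw [div_sub_div _ _ (by positivity) (by positivity), div_le_div_iff₀ (by positivity)
        (by positivity)]
      nlinarith [sq_nonneg ((n : ℝ) + m)]
    linarith

theorem summable_inv_sq_shift (n : ℕ) : Summable fun j : ℕ => 1 / ((j : ℝ) + n + 1) ^ 2 := by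
  have h := (summable_nat_add_iff (n + 1)).2 (Real.summable_one_div_nat_pow.2 one_lt_two)
  simpa [add_assoc] using h

theorem tsum_inv_sq_shift_le {n : ℕ} (hn : 1 ≤ n) :
    ∑' j : ℕ, 1 / ((j : ℝ) + n + 1) ^ 2 ≤ 1 / (n : ℝ) := by
  refine Real.tsum_le_of_sum_range_le (fun _ => by positivity) fun m => ?_
  have := sum_inv_sq_shift_le hn m
  have h2 : 0 ≤ 1 / ((n : ℝ) + m) := by positivity
  linarith

theorem Real.exp_sub_one_le_mul_exp {t T : ℝ} (h0 : 0 ≤ t) (hT : t ≤ T) :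
    Real.exp t - 1 ≤ t * Real.exp T := by
  have h1 := Real.add_one_le_exp (-t)
  have h2 : Real.exp t * Real.exp (-t) = 1 := by rw [← Real.exp_add]; simp
  have h3 : Real.exp t ≤ Real.exp T := Real.exp_le_exp.2 hT
  nlinarith [Real.exp_pos t]

/-- The product `∏_{j ≥ 1} (1 + z / j) exp (-z / j)`. -/
noncomputable def gammaProduct (z : ℂ) : ℂ := ∏' j : ℕ, bernoulliFactor (z / (j + 1))

theorem norm_bernoulliFactor_div_sub_one_le {R : ℝ} {z : ℂ} (hz : ‖z‖ ≤ R) (j n : ℕ) :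
    ‖bernoulliFactor (z / ((j + n : ℕ) + 1)) - 1‖
      ≤ ((1 + R) * Real.exp R + 1) * R ^ 2 * (1 / ((j : ℝ) + n + 1) ^ 2) := by
  have e : ‖z / (((j + n : ℕ) : ℂ) + 1)‖ = ‖z‖ / ((j : ℝ) + n + 1) := by
    rw [norm_div]
    congr 1
    have : (((j + n : ℕ) : ℂ) + 1) = ((j + n + 1 : ℕ) : ℂ) := by push_cast; ring
    rw [this, Complex.norm_natCast]; push_cast; ring
  have hR : 0 ≤ R := (norm_nonneg _).trans hz
  have h1 : (1 : ℝ) ≤ (j : ℝ) + n + 1 := by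
    have : (0 : ℝ) ≤ (j : ℝ) + n := by positivity
    linarith
  refine (norm_bernoulliFactor_sub_one_le (R := R) ?_).trans ?_
  · rw [e]; exact (div_le_self (norm_nonneg _) h1).trans hz
  · rw [e, div_pow, mul_assoc]
    gcongr
    rw [mul_one_div]
    gcongr

theorem summable_bernoulliFactor_div (z : ℂ) (n : ℕ) :
    Summable fun j : ℕ => ‖bernoulliFactor (z / ((j + n : ℕ) + 1)) - 1‖ :=
  Summable.of_nonneg_of_le (fun _ => norm_nonneg _)
    (fun j => norm_bernoulliFactor_div_sub_one_le le_rfl j n) ((summable_inv_sq_shift n).mul_left _)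

theorem multipliable_bernoulliFactor_div (z : ℂ) (n : ℕ) :
    Multipliable fun j : ℕ => bernoulliFactor (z / ((j + n : ℕ) + 1)) := by
  simpa using multipliable_one_add_of_summable (summable_bernoulliFactor_div z n)

theorem prod_mul_tail_gammaProduct (z : ℂ) (n : ℕ) :
    (∏ j ∈ Finset.range n, bernoulliFactor (z / (j + 1))) *
      ∏' j : ℕ, bernoulliFactor (z / ((j + n : ℕ) + 1)) = gammaProduct z :=
  Multipliable.prod_mul_tprod_nat_mul' (f := fun j : ℕ => bernoulliFactor (z / (j + 1)))
    (multipliable_bernoulliFactor_div z n)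

theorem norm_tail_gammaProduct_sub_one_le {R : ℝ} {z : ℂ} (hz : ‖z‖ ≤ R) {n : ℕ} (hn : 1 ≤ n) :
    ‖∏' j : ℕ, bernoulliFactor (z / ((j + n : ℕ) + 1)) - 1‖
      ≤ ((1 + R) * Real.exp R + 1) * R ^ 2 *
        Real.exp (((1 + R) * Real.exp R + 1) * R ^ 2) / n := by
  have hR : 0 ≤ R := (norm_nonneg _).trans hz
  set c := ((1 + R) * Real.exp R + 1) * R ^ 2 with hc
  have hc0 : 0 ≤ c := by positivity
  have h1 := norm_tprod_one_add_sub_one_le (summable_bernoulliFactor_div z n)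
  simp only [add_sub_cancel] at h1
  have hn' : (1 : ℝ) ≤ n := by exact_mod_cast hn
  have h2 : ∑' j : ℕ, ‖bernoulliFactor (z / ((j + n : ℕ) + 1)) - 1‖ ≤ c / n := by
    calc _ ≤ ∑' j : ℕ, c * (1 / ((j : ℝ) + n + 1) ^ 2) :=
          (summable_bernoulliFactor_div z n).tsum_le_tsum
            (fun j => norm_bernoulliFactor_div_sub_one_le hz j n)
            ((summable_inv_sq_shift n).mul_left _)
      _ ≤ c * (1 / n) := by rw [tsum_mul_left]; gcongr; exact tsum_inv_sq_shift_le hn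
      _ = c / n := by ring
  have h3 : c / n ≤ c := div_le_self hc0 hn'
  calc _ ≤ _ := h1
    _ ≤ Real.exp (c / n) - 1 := by gcongr
    _ ≤ c / n * Real.exp c := Real.exp_sub_one_le_mul_exp (by positivity) h3
    _ = _ := by ring

theorem norm_prod_bernoulliFactor_div_le {R : ℝ} {z : ℂ} (hz : ‖z‖ ≤ R) (n : ℕ) :
    ‖∏ j ∈ Finset.range n, bernoulliFactor (z / (j + 1))‖
      ≤ Real.exp (((1 + R) * Real.exp R + 1) * R ^ 2 * 2) := by
  have hR : 0 ≤ R := (norm_nonneg _).trans hz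
  have h := Finset.norm_prod_one_add_sub_one_le (Finset.range n)
    fun j : ℕ => bernoulliFactor (z / (j + 1)) - 1
  simp only [add_sub_cancel] at h
  have h2 : ∑ j ∈ Finset.range n, ‖bernoulliFactor (z / (j + 1)) - 1‖
      ≤ ((1 + R) * Real.exp R + 1) * R ^ 2 * 2 := by
    have hs : ∀ m, ∑ j ∈ Finset.range m, 1 / ((j : ℝ) + 1) ^ 2 ≤ 2 := by
      intro m
      rcases m with _ | m
      · simp
      rw [Finset.sum_range_succ']
      have := sum_inv_sq_shift_le le_rfl m
      have h0 : (0 : ℝ) ≤ (1 + (m : ℝ))⁻¹ := by positivity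
      push_cast at this ⊢
      norm_num at this ⊢
      linarith
    calc _ ≤ ∑ j ∈ Finset.range n, ((1 + R) * Real.exp R + 1) * R ^ 2 * (1 / ((j : ℝ) + 1) ^ 2) :=
          Finset.sum_le_sum fun j _ => by
            simpa using norm_bernoulliFactor_div_sub_one_le hz j 0
      _ ≤ _ := by rw [← Finset.mul_sum]; gcongr; exact hs n
  have h3 := norm_add_le (∏ j ∈ Finset.range n, bernoulliFactor (z / (j + 1)) - 1) 1
  rw [sub_add_cancel, norm_one] at h3
  have h4 := Real.exp_le_exp.2 h2
  linarith

/-- The compensators `exp (-z / j)` for `j ≤ n` multiply to `exp (-z H_n)`, which the last factor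
undoes. -/
theorem risingCoeff_eq_prod_mul_exp (z : ℂ) (n : ℕ) :
    risingCoeff z n = (∏ j ∈ Finset.range n, bernoulliFactor (z / (j + 1))) *
      Complex.exp (z * ((harmonic n : ℝ) : ℂ)) := by
  induction n with
  | zero => simp [risingCoeff]
  | succ n ih =>
    rw [risingCoeff_succ, ih, Finset.prod_range_succ, harmonic_succ, bernoulliFactor]
    have : z * (((harmonic n + (((n + 1 : ℕ) : ℚ))⁻¹ : ℚ) : ℝ) : ℂ)
        = z * ((harmonic n : ℝ) : ℂ) + z / (n + 1) := by
      push_cast; ring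
    rw [this, Complex.exp_add]
    have h2 : Complex.exp (-(z / (n + 1))) * Complex.exp (z / (n + 1)) = 1 := by
      rw [← Complex.exp_add]; simp
    linear_combination (- (∏ j ∈ Finset.range n, bernoulliFactor (z / (j + 1))) *
      Complex.exp (z * ((harmonic n : ℝ) : ℂ)) * (1 + z / (n + 1))) * h2

theorem norm_exp_sub_one_le {R : ℝ} {u : ℂ} (hu : ‖u‖ ≤ R) :
    ‖Complex.exp u - 1‖ ≤ ‖u‖ * Real.exp R := by
  have h := Complex.norm_exp_sub_sum_le_norm_mul_exp u 1
  simp at h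
  exact h.trans (by gcongr)

theorem norm_exp_le_exp {R : ℝ} {u : ℂ} (hu : ‖u‖ ≤ R) : ‖Complex.exp u‖ ≤ Real.exp R := by
  rw [Complex.norm_exp]
  exact Real.exp_le_exp.2 ((Complex.re_le_norm u).trans hu)

/-- The limit of `∏_{1 ≤ j ≤ n} (1 + z / j) / n ^ z`, that is, `1 / Γ (1 + z)`. -/
noncomputable def risingLimit (z : ℂ) : ℂ :=
  gammaProduct z * Complex.exp (z * (Real.eulerMascheroniConstant : ℂ))

/-- Two errors of order `1/n` occur: replacing `H_n` by `log n + γ`, and completing the finite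
product to `gammaProduct`. The base `n + 1` in the size bound keeps `n = 0` meaningful. -/
theorem exists_risingCoeff_bounds (R : ℝ) :
    ∃ C : ℝ, 0 ≤ C ∧ ∀ z : ℂ, ‖z‖ ≤ R →
      ‖risingLimit z‖ ≤ C ∧
      (∀ n : ℕ, ‖risingCoeff z n‖ ≤ C * ((n : ℝ) + 1) ^ z.re) ∧
      ∀ n : ℕ, 1 ≤ n →
        ‖risingCoeff z n * Complex.exp (-(z * (Real.log n : ℝ))) - risingLimit z‖ ≤ C / n := by
  rcases lt_or_ge R 0 with hR | hR
  · exact ⟨0, le_rfl, fun z hz => absurd ((norm_nonneg z).trans hz) (not_le.2 hR)⟩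
  set c := ((1 + R) * Real.exp R + 1) * R ^ 2 with hc
  have hc0 : 0 ≤ c := by positivity
  set D := Real.exp (c * 2) with hD
  set T := c * Real.exp c with hT
  have hD0 : 0 ≤ D := by positivity
  have hT0 : 0 ≤ T := by positivity
  have hγ0 : 0 ≤ Real.eulerMascheroniConstant := by
    have := Real.one_half_lt_eulerMascheroniConstant; linarith
  have hγ1 : Real.eulerMascheroniConstant ≤ 1 := by
    have := Real.eulerMascheroniConstant_lt_two_thirds; linarith
  have hzt : ∀ z : ℂ, ‖z‖ ≤ R → ∀ t : ℝ, 0 ≤ t → t ≤ 1 → ‖z * (t : ℂ)‖ ≤ R := by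
    intro z hz t h0 h1
    rw [norm_mul, Complex.norm_real, Real.norm_of_nonneg h0]
    calc ‖z‖ * t ≤ R * 1 := by gcongr
      _ = R := mul_one R
  have hrate : ∀ z : ℂ, ‖z‖ ≤ R → ∀ n : ℕ, 1 ≤ n →
        ‖risingCoeff z n * Complex.exp (-(z * (Real.log n : ℝ))) - risingLimit z‖
          ≤ (D * Real.exp R * (R * Real.exp R) + D * T * Real.exp R) / n := by
    intro z hz n hn
    have hn' : (1 : ℝ) ≤ n := by exact_mod_cast hn
    set Q := ∏ j ∈ Finset.range n, bernoulliFactor (z / (j + 1)) with hQ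
    have hQD : ‖Q‖ ≤ D := norm_prod_bernoulliFactor_div_le hz n
    set γ := Real.eulerMascheroniConstant with hγ
    -- `0 ≤ δ ≤ 1/n`, as `γ` lies between `H_n - log (n + 1)` and `H_n - log n`.
    set δ : ℝ := (harmonic n : ℝ) - Real.log n - γ with hδ
    have hδ0 : 0 ≤ δ := by
      have h := Real.eulerMascheroniConstant_lt_eulerMascheroniSeq' n
      rw [Real.eulerMascheroniSeq', if_neg (by omega)] at h
      rw [hδ]; linarith
    have hδ1 : δ ≤ 1 / n := by
      have h := Real.eulerMascheroniSeq_lt_eulerMascheroniConstant n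
      rw [Real.eulerMascheroniSeq] at h
      have h2 : Real.log (n + 1) - Real.log n ≤ 1 / n := by
        rw [← Real.log_div (by positivity) (by positivity)]
        refine (Real.log_le_sub_one_of_pos (by positivity)).trans_eq ?_
        field_simp; ring
      rw [hδ]; linarith
    have hδ1' : δ ≤ 1 := hδ1.trans (by rw [div_le_one (by positivity)]; exact hn')
    have e1 : risingCoeff z n * Complex.exp (-(z * (Real.log n : ℝ)))
        = Q * (Complex.exp (z * (γ : ℂ)) * Complex.exp (z * (δ : ℂ))) := by
      rw [risingCoeff_eq_prod_mul_exp, mul_assoc, ← Complex.exp_add, ← Complex.exp_add]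
      congr 2
      rw [hδ]; push_cast; ring
    have e2 : risingLimit z = Q * (∏' j : ℕ, bernoulliFactor (z / ((j + n : ℕ) + 1))) *
        Complex.exp (z * (γ : ℂ)) := by
      rw [risingLimit, ← prod_mul_tail_gammaProduct z n]
    have e3 : risingCoeff z n * Complex.exp (-(z * (Real.log n : ℝ))) - risingLimit z
        = Q * Complex.exp (z * (γ : ℂ)) * (Complex.exp (z * (δ : ℂ)) - 1)
          - Q * (∏' j : ℕ, bernoulliFactor (z / ((j + n : ℕ) + 1)) - 1) *
            Complex.exp (z * (γ : ℂ)) := by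
      rw [e1, e2]; ring
    have hexpγ : ‖Complex.exp (z * (γ : ℂ))‖ ≤ Real.exp R := norm_exp_le_exp (hzt z hz γ hγ0 hγ1)
    have hexpδ : ‖Complex.exp (z * (δ : ℂ)) - 1‖ ≤ R * Real.exp R / n := by
      refine (norm_exp_sub_one_le (hzt z hz δ hδ0 hδ1')).trans ?_
      rw [norm_mul, Complex.norm_real, Real.norm_of_nonneg hδ0]
      calc ‖z‖ * δ * Real.exp R ≤ R * (1 / n) * Real.exp R := by gcongr
        _ = _ := by ring
    have htail := norm_tail_gammaProduct_sub_one_le hz hn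
    rw [← hc, ← hT] at htail
    rw [e3]
    refine (norm_sub_le _ _).trans ?_
    rw [norm_mul, norm_mul, norm_mul, norm_mul]
    calc _ ≤ D * Real.exp R * (R * Real.exp R / n) + D * (T / n) * Real.exp R := by gcongr
      _ = _ := by ring
  have hbound : ∀ z : ℂ, ‖z‖ ≤ R → ∀ n : ℕ,
      ‖risingCoeff z n‖ ≤ D * Real.exp R * ((n : ℝ) + 1) ^ z.re := by
    intro z hz n
    have hQD := norm_prod_bernoulliFactor_div_le hz n
    rw [← hc, ← hD] at hQD
    set δ : ℝ := (harmonic n : ℝ) - Real.log (n + 1) with hδ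
    have hδ1 : δ ≤ 1 := (Real.eulerMascheroniSeq_lt_eulerMascheroniConstant n).le.trans hγ1
    have hδ0 : 0 ≤ δ := by
      have := Real.strictMono_eulerMascheroniSeq.monotone (Nat.zero_le n)
      rw [Real.eulerMascheroniSeq_zero] at this
      exact this
    have e1 : Complex.exp (z * ((harmonic n : ℝ) : ℂ))
        = Complex.exp (z * (δ : ℂ)) * Complex.exp (z * (Real.log (n + 1) : ℂ)) := by
      rw [← Complex.exp_add]; congr 1; rw [hδ]; push_cast; ring
    have e2 : ‖Complex.exp (z * (Real.log (n + 1) : ℂ))‖ = ((n : ℝ) + 1) ^ z.re := by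
      rw [Complex.norm_exp, Real.rpow_def_of_pos (by positivity)]
      congr 1
      rw [Complex.re_mul_ofReal, mul_comm]
    rw [risingCoeff_eq_prod_mul_exp, e1, norm_mul, norm_mul, e2, ← mul_assoc]
    gcongr
    exact norm_exp_le_exp (hzt z hz δ hδ0 hδ1)
  set A := D * Real.exp R * (R * Real.exp R) + D * T * Real.exp R with hA
  have hA0 : 0 ≤ A := by positivity
  have hB0 : 0 ≤ D * Real.exp R := by positivity
  have hE0 : 0 ≤ D * Real.exp R * 2 ^ R := by positivity
  refine ⟨A + D * Real.exp R + D * Real.exp R * 2 ^ R, by positivity, fun z hz =>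
    ⟨?_, fun n => (hbound z hz n).trans ?_, fun n hn => (hrate z hz n hn).trans ?_⟩⟩
  -- The limit is bounded by comparing it with the term `n = 1`, where `log n = 0`; this is the
  -- origin of the summand with `2 ^ R` in the constant.
  · have h1 := hrate z hz 1 le_rfl
    have h2 := hbound z hz 1
    have h3 : (((1 : ℕ) : ℝ) + 1) ^ z.re ≤ (2 : ℝ) ^ R := by
      rw [Nat.cast_one, one_add_one_eq_two]
      exact Real.rpow_le_rpow_of_exponent_le one_le_two ((Complex.re_le_norm z).trans hz)
    have h4 := norm_sub_norm_le (risingLimit z) (risingCoeff z 1)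
    have h5 : D * Real.exp R * (((1 : ℕ) : ℝ) + 1) ^ z.re ≤ D * Real.exp R * 2 ^ R := by gcongr
    rw [norm_sub_rev] at h4
    simp at h1 h2 h4
    norm_num at h5
    norm_num at h2
    linarith
  · gcongr; linarith
  · gcongr; linarith

/-! ### Counting monic and irreducible polynomials. -/

/-- The monic irreducible polynomials over `F`. -/
abbrev MonicIrreducible (F : Type*) [Field F] : Type _ := {Q : F[X] // Q.Monic ∧ Irreducible Q}

namespace MonicIrreducible

/-- The degree of a monic irreducible polynomial. -/
def deg {F : Type*} [Field F] (Q : MonicIrreducible F) : ℕ := (Q : F[X]).natDegree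

theorem deg_pos {F : Type*} [Field F] (Q : MonicIrreducible F) : 1 ≤ Q.deg :=
  Q.2.2.natDegree_pos

end MonicIrreducible

open MonicIrreducible

section Counting

set_option linter.unusedSectionVars false

variable (F : Type*) [Field F]

/-- The number of monic irreducible polynomials of degree `d`. -/
noncomputable def irrCount (d : ℕ) : ℕ := Nat.card ((deg : MonicIrreducible F → ℕ) ⁻¹' {d})

variable [Fintype F]

/-- Subtracting `X ^ n` gives a bijection with the polynomials of degree less than `n`. -/
theorem card_monic_natDegree (n : ℕ) :
    Nat.card {p : F[X] // p.Monic ∧ p.natDegree = n} = Fintype.card F ^ n := by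
  have e : {p : F[X] // p.Monic ∧ p.natDegree = n} ≃ degreeLT F n :=
    { toFun := fun p => ⟨p.1 - X ^ n, by
        rw [mem_degreeLT]
        by_cases h0 : p.1 - X ^ n = 0
        · rw [h0, degree_zero]; exact WithBot.bot_lt_coe n
        have hd : p.1.degree = n := by rw [degree_eq_natDegree p.2.1.ne_zero, p.2.2]
        calc _ < p.1.degree := degree_sub_lt_left (by rw [hd, degree_X_pow]) p.2.1.ne_zero
              (by rw [p.2.1.leadingCoeff, leadingCoeff_X_pow])
          _ = n := hd⟩
      invFun := fun p => ⟨X ^ n + p.1, monic_X_pow_add (mem_degreeLT.1 p.2), by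
        rw [natDegree_add_eq_left_of_degree_lt, natDegree_X_pow]
        rw [degree_X_pow]; exact mem_degreeLT.1 p.2⟩
      left_inv := fun p => by simp
      right_inv := fun p => by simp }
  rw [Nat.card_congr (e.trans (degreeLTEquiv F n).toEquiv), Nat.card_eq_fintype_card]
  simp

theorem finite_monic_natDegree (n : ℕ) : Finite {p : F[X] // p.Monic ∧ p.natDegree = n} := by
  refine Nat.finite_of_card_ne_zero ?_
  rw [card_monic_natDegree]
  exact pow_ne_zero _ Fintype.card_ne_zero

theorem injective_fiber_deg (d : ℕ) : Function.Injective
    (fun Q : (deg : MonicIrreducible F → ℕ) ⁻¹' {d} =>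
      (⟨Q.1.1, Q.1.2.1, Q.2⟩ : {p : F[X] // p.Monic ∧ p.natDegree = d})) := by
  intro Q Q' h
  simpa [Subtype.ext_iff] using h

theorem finite_fiber_deg (d : ℕ) : Finite ((deg : MonicIrreducible F → ℕ) ⁻¹' {d}) :=
  have := finite_monic_natDegree F d
  Finite.of_injective _ (injective_fiber_deg F d)

theorem irrCount_le (d : ℕ) : irrCount F d ≤ Fintype.card F ^ d := by
  have := finite_monic_natDegree F d
  rw [irrCount, ← card_monic_natDegree]
  exact Nat.card_le_card_of_injective _ (injective_fiber_deg F d)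

theorem irrCount_zero : irrCount F 0 = 0 := by
  rw [irrCount]
  have : IsEmpty ((deg : MonicIrreducible F → ℕ) ⁻¹' {0}) :=
    ⟨fun Q => by have := Q.1.deg_pos; have h : Q.1.deg = 0 := Q.2; omega⟩
  exact Nat.card_of_isEmpty

-- `X ^ (q ^ n) - X` is squarefree, and its monic irreducible factors are exactly those of degree
-- dividing `n`; compare degrees.
open Classical in
theorem sum_divisors_mul_irrCount {n : ℕ} (hn : 0 < n) :
    ∑ d ∈ n.divisors, d * irrCount F d = Fintype.card F ^ n := by
  set f : F[X] := X ^ (Fintype.card F ^ n) - X with hf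
  have hq : 1 < Fintype.card F := Fintype.one_lt_card
  have hfd : f.natDegree = Fintype.card F ^ n :=
    FiniteField.X_pow_card_pow_sub_X_natDegree_eq F hn.ne' hq
  have hf0 : f ≠ 0 := FiniteField.X_pow_card_pow_sub_X_ne_zero F hn.ne' hq
  obtain ⟨p, hp⟩ := CharP.exists F
  have hsq : Squarefree f := by
    refine (galois_poly_separable p _ ?_).squarefree
    have h1 : p ∣ Fintype.card F := by
      have := (CharP.cast_eq_zero_iff F p (Fintype.card F)).1 (FiniteField.cast_card_eq_zero F)
      exact this
    exact h1.trans (dvd_pow_self _ hn.ne')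
  have hnodup := (UniqueFactorizationMonoid.squarefree_iff_nodup_normalizedFactors hf0).1 hsq
  set S := UniqueFactorizationMonoid.normalizedFactors f with hS
  have hmem : ∀ Q : F[X], Q ∈ S.toFinset ↔ Q.Monic ∧ Irreducible Q ∧ Q.natDegree ∣ n := by
    intro Q
    rw [Multiset.mem_toFinset, hS, UniqueFactorizationMonoid.mem_normalizedFactors_iff' hf0]
    constructor
    · rintro ⟨hi, hnorm, hdvd⟩
      refine ⟨?_, hi, ?_⟩
      · rw [← hnorm]; exact Polynomial.monic_normalize hi.ne_zero
      · rw [hi.natDegree_dvd_iff_dvd_X_pow_card_pow_sub_X, Nat.card_eq_fintype_card]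
        exact hdvd
    · rintro ⟨hm, hi, hdvd⟩
      refine ⟨hi, hm.normalize_eq_self, ?_⟩
      rw [hi.natDegree_dvd_iff_dvd_X_pow_card_pow_sub_X, Nat.card_eq_fintype_card] at hdvd
      exact hdvd
  have hdeg : ∑ Q ∈ S.toFinset, Q.natDegree = Fintype.card F ^ n := by
    have h1 : S.prod.natDegree = f.natDegree :=
      Polynomial.natDegree_eq_of_degree_eq
        (Polynomial.degree_eq_degree_of_associated
          (UniqueFactorizationMonoid.prod_normalizedFactors hf0))
    rw [Polynomial.natDegree_multiset_prod S
      (UniqueFactorizationMonoid.zero_notMem_normalizedFactors f), hfd] at h1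
    rw [← h1, Finset.sum, Multiset.toFinset_val, Multiset.dedup_eq_self.2 hnodup]
  rw [← hdeg, ← Finset.sum_fiberwise_of_maps_to (t := n.divisors) (g := natDegree)
    (fun Q hQ => Nat.mem_divisors.2 ⟨((hmem Q).1 hQ).2.2, hn.ne'⟩)]
  refine Finset.sum_congr rfl fun d hd => ?_
  rw [Finset.sum_congr rfl (fun Q hQ => (Finset.mem_filter.1 hQ).2), Finset.sum_const,
    smul_eq_mul, mul_comm]
  congr 1
  rw [irrCount, ← Nat.card_eq_finsetCard]
  refine Nat.card_congr
    { toFun := fun Q => ⟨Q.1.1, ?_⟩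
      invFun := fun Q => ⟨⟨Q.1, ?_⟩, ?_⟩
      left_inv := fun Q => rfl
      right_inv := fun Q => rfl }
  · have hQ : (Q.1 : F[X]).natDegree = d := Q.2
    rw [Finset.mem_filter, hmem, hQ]
    exact ⟨⟨Q.1.2.1, Q.1.2.2, Nat.dvd_of_mem_divisors hd⟩, rfl⟩
  · have h := (hmem Q.1).1 (Finset.mem_filter.1 Q.2).1
    exact ⟨h.1, h.2.1⟩
  · exact (Finset.mem_filter.1 Q.2).2

theorem natCast_mul_irrCount {n : ℕ} (hn : 0 < n) :
    ∑ x ∈ n.divisorsAntidiagonal, (ArithmeticFunction.moebius x.1 : ℝ) *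
      (Fintype.card F : ℝ) ^ x.2 = n * irrCount F n := by
  refine (ArithmeticFunction.sum_eq_iff_sum_mul_moebius_eq
    (f := fun n => (n * irrCount F n : ℝ)) (g := fun n => (Fintype.card F : ℝ) ^ n)).1 ?_ n hn
  intro n hn
  exact_mod_cast sum_divisors_mul_irrCount F hn

/-! ### The defect in the prime polynomial theorem and its sum `R_q`. -/

/-- The defect `N_d / q ^ d - 1 / d` in the prime polynomial theorem. -/
noncomputable def irrDefect (d : ℕ) : ℝ :=
  irrCount F d / (Fintype.card F : ℝ) ^ d - 1 / d

theorem irrDefect_zero : irrDefect F 0 = 0 := by simp [irrDefect, irrCount_zero]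

/-- The summand of index `(k, m)` in the double series for `∑ d, irrDefect F d`. -/
noncomputable def defectTerm (q : ℕ) (x : ℕ × ℕ) : ℝ :=
  if 2 ≤ x.1 ∧ 1 ≤ x.2 then
    (ArithmeticFunction.moebius x.1 : ℝ) / (x.1 * x.2) * ((q : ℝ)⁻¹) ^ ((x.1 - 1) * x.2) else 0

/-- In the Möbius formula for `N_d / q ^ d`, the pair `(1, d)` contributes exactly `1/d`. The other
pairs `(k, m)` have `k ≥ 2` and contribute `μ(k) / (k m)` times `q ^ m / q ^ (k m)`. -/
theorem sum_defectTerm {d : ℕ} (hd : 0 < d) :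
    ∑ x ∈ d.divisorsAntidiagonal, defectTerm (Fintype.card F) x = irrDefect F d := by
  have hq : (0 : ℝ) < Fintype.card F := by exact_mod_cast Fintype.card_pos
  have hd' : (0 : ℝ) < d := by exact_mod_cast hd
  have h1 : (irrCount F d : ℝ) / (Fintype.card F : ℝ) ^ d = ∑ x ∈ d.divisorsAntidiagonal,
      (ArithmeticFunction.moebius x.1 : ℝ) / d * ((Fintype.card F : ℝ) ^ x.2 /
        (Fintype.card F : ℝ) ^ d) := by
    have : (irrCount F d : ℝ) = (d * irrCount F d) / d := by field_simp
    rw [this, ← natCast_mul_irrCount F hd, Finset.sum_div, Finset.sum_div]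
    refine Finset.sum_congr rfl fun x _ => ?_
    ring
  have hmem : (1, d) ∈ d.divisorsAntidiagonal := by simp [hd.ne']
  rw [irrDefect, h1, ← Finset.add_sum_erase _ _ hmem, ← Finset.add_sum_erase _ _ hmem]
  have h2 : defectTerm (Fintype.card F) (1, d) = 0 := by simp [defectTerm]
  rw [h2, zero_add]
  have h3 : ((Fintype.card F : ℝ) ^ d / (Fintype.card F : ℝ) ^ d) = 1 :=
    div_self (pow_ne_zero _ hq.ne')
  simp only [h3, ArithmeticFunction.moebius_apply_one, Int.cast_one, mul_one, add_sub_cancel_left]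
  refine Finset.sum_congr rfl fun x hx => ?_
  obtain ⟨k, m⟩ := x
  rw [Finset.mem_erase, Nat.mem_divisorsAntidiagonal] at hx
  obtain ⟨hne, hkm, -⟩ := hx
  have hkm : k * m = d := hkm
  have hm : 1 ≤ m := by rcases m with _ | m <;> simp_all
  have hk : 2 ≤ k := by
    rcases k with _ | _ | k
    · simp_all
    · simp at hkm; simp [hkm] at hne
    · omega
  rw [defectTerm, if_pos ⟨hk, hm⟩]
  obtain ⟨j, rfl⟩ : ∃ j, k = j + 1 := ⟨k - 1, by omega⟩
  have hpow : (Fintype.card F : ℝ) ^ m / (Fintype.card F : ℝ) ^ d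
      = ((Fintype.card F : ℝ)⁻¹) ^ (j * m) := by
    rw [← hkm, inv_pow, div_eq_iff (by positivity)]
    have : (j + 1) * m = j * m + m := by ring
    rw [this, pow_add, ← mul_assoc, inv_mul_cancel₀ (by positivity), one_mul]
  simp only [hpow, Nat.add_sub_cancel]
  rw [← hkm]
  push_cast
  rfl

end Counting

theorem abs_defectTerm_le {q : ℕ} (k m : ℕ) :
    |defectTerm q (k, m)| ≤ 1 / (k * m) * ((q : ℝ)⁻¹) ^ ((k - 1) * m) := by
  rw [defectTerm]
  split_ifs with h
  · have hm : |(ArithmeticFunction.moebius k : ℝ)| ≤ 1 := by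
      exact_mod_cast ArithmeticFunction.abs_moebius_le_one (n := k)
    rw [abs_mul, abs_div, abs_of_nonneg (by positivity : (0 : ℝ) ≤ (k : ℝ) * m),
      abs_of_nonneg (by positivity : (0 : ℝ) ≤ ((q : ℝ)⁻¹) ^ ((k - 1) * m))]
    gcongr
  · rw [abs_zero]; positivity

theorem inv_natCast_le_half {q : ℕ} (hq : 2 ≤ q) : (q : ℝ)⁻¹ ≤ 1 / 2 := by
  rw [one_div]; exact inv_anti₀ two_pos (by exact_mod_cast hq)

/-- Since `1/q ≤ 1/2 ≤ (3/4)^2` and `2 (k - 1) ≥ k` for `k ≥ 2`, the decay depends only on the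
product `k m`. -/
theorem abs_defectTerm_le_pow {q : ℕ} (hq : 2 ≤ q) (x : ℕ × ℕ) :
    |defectTerm q x| ≤ 1 / (x.1 * x.2 : ℝ) * (3 / 4 : ℝ) ^ (x.1 * x.2) := by
  obtain ⟨k, m⟩ := x
  by_cases h : 2 ≤ k ∧ 1 ≤ m
  · refine (abs_defectTerm_le k m).trans ?_
    gcongr
    calc ((q : ℝ)⁻¹) ^ ((k - 1) * m) ≤ ((3 / 4 : ℝ) ^ 2) ^ ((k - 1) * m) := by
          gcongr
          exact (inv_natCast_le_half hq).trans (by norm_num)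
      _ = (3 / 4 : ℝ) ^ (2 * ((k - 1) * m)) := (pow_mul _ _ _).symm
      _ ≤ (3 / 4 : ℝ) ^ (k * m) := by
          refine pow_le_pow_of_le_one (by norm_num) (by norm_num) ?_
          rw [← mul_assoc]
          exact Nat.mul_le_mul_right m (by omega)
  · rw [defectTerm, if_neg h, abs_zero]; positivity

theorem summable_defectTerm {q : ℕ} (hq : 2 ≤ q) : Summable (defectTerm q) := by
  have hg : Summable fun x : ℕ × ℕ => 4 * (((1 / 2 : ℝ) ^ x.1) * ((1 / 2 : ℝ) ^ x.2)) :=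
    ((summable_geometric_two).mul_of_nonneg summable_geometric_two
      (fun _ => by positivity) (fun _ => by positivity)).mul_left 4
  refine Summable.of_norm_bounded hg fun x => ?_
  obtain ⟨k, m⟩ := x
  rw [Real.norm_eq_abs]
  by_cases h : 2 ≤ k ∧ 1 ≤ m
  · refine (abs_defectTerm_le k m).trans ?_
    obtain ⟨hk, hm⟩ := h
    have h1 : (1 : ℝ) ≤ (k : ℝ) * m := by
      exact_mod_cast Nat.one_le_iff_ne_zero.2 (Nat.mul_ne_zero (by omega) (by omega))
    calc 1 / ((k : ℝ) * m) * ((q : ℝ)⁻¹) ^ ((k - 1) * m)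
        ≤ 1 * (1 / 2 : ℝ) ^ ((k - 1) * m) := by
          gcongr
          · rw [div_le_one (by linarith)]; exact h1
          · exact inv_natCast_le_half hq
      _ ≤ (1 / 2 : ℝ) ^ (k + m - 2) := by
          rw [one_mul]
          -- `(k - 1) m ≥ k + m - 2` separates the variables.
          refine pow_le_pow_of_le_one (by norm_num) (by norm_num) ?_
          obtain ⟨a, rfl⟩ : ∃ a, k = a + 2 := ⟨k - 2, by omega⟩
          obtain ⟨b, rfl⟩ : ∃ b, m = b + 1 := ⟨m - 1, by omega⟩
          have : (a + 2 - 1) * (b + 1) = a * b + a + b + 1 := by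
            simp; ring
          rw [this]
          have := Nat.zero_le (a * b)
          omega
      _ ≤ 4 * (((1 / 2 : ℝ) ^ k) * ((1 / 2 : ℝ) ^ m)) := by
          obtain ⟨b, hb⟩ : ∃ b, k + m = b + 2 := ⟨k + m - 2, by omega⟩
          rw [← pow_add, hb, Nat.add_sub_cancel, pow_add]
          linarith
  · rw [defectTerm, if_neg h, abs_zero]; positivity

/-- There are at most `d` divisor pairs, which the factor `1/d` in each term absorbs. -/
theorem abs_irrDefect_le (F : Type*) [Field F] [Fintype F] (d : ℕ) :
    |irrDefect F d| ≤ (3 / 4 : ℝ) ^ d := by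
  rcases Nat.eq_zero_or_pos d with rfl | hd
  · simp [irrDefect_zero]
  have hd' : (0 : ℝ) < d := by exact_mod_cast hd
  rw [← sum_defectTerm F hd]
  refine (Finset.abs_sum_le_sum_abs _ _).trans ?_
  have h : ∀ x ∈ d.divisorsAntidiagonal, |defectTerm (Fintype.card F) x|
      ≤ 1 / (d : ℝ) * (3 / 4 : ℝ) ^ d := by
    intro x hx
    have hxd : x.1 * x.2 = d := (Nat.mem_divisorsAntidiagonal.1 hx).1
    have := abs_defectTerm_le_pow (q := Fintype.card F) Fintype.one_lt_card x
    rw [← Nat.cast_mul, hxd] at this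
    exact this
  refine (Finset.sum_le_card_nsmul _ _ _ h).trans ?_
  rw [nsmul_eq_mul, ← mul_assoc]
  have hc : ((d.divisorsAntidiagonal.card : ℕ) : ℝ) ≤ d := by
    rw [← Nat.map_div_right_divisors, Finset.card_map]
    exact_mod_cast Nat.card_divisors_le_self d
  calc _ ≤ (d : ℝ) * (1 / d) * (3 / 4 : ℝ) ^ d := by gcongr
    _ = _ := by rw [mul_one_div_cancel hd'.ne', one_mul]

/-- For fixed `k ≥ 2`, the sum over `m` is the Taylor series of `-log (1 - t)` at `t = q ^ (1 - k)`.
-/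
theorem tsum_defectTerm {q : ℕ} (hq : 2 ≤ q) : ∑' x, defectTerm q x = polyR q := by
  have hq0 : (0 : ℝ) < (q : ℝ)⁻¹ := by
    have : (0 : ℝ) < q := by exact_mod_cast (by omega : 0 < q)
    positivity
  have hs := summable_defectTerm hq
  rw [hs.tsum_prod, ← hs.prod.sum_add_tsum_nat_add 2]
  have h0 : ∑ k ∈ Finset.range 2, ∑' m, defectTerm q (k, m) = 0 := by
    refine Finset.sum_eq_zero fun k hk => ?_
    have hk : k < 2 := Finset.mem_range.1 hk
    have : ∀ m, defectTerm q (k, m) = 0 := fun m => by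
      rw [defectTerm, if_neg]; simp only; omega
    simp [this]
  rw [h0, zero_add, polyR]
  refine tsum_congr fun j => ?_
  have hz : (q : ℝ) ^ (1 - ((j + 2 : ℕ) : ℤ)) = ((q : ℝ)⁻¹) ^ (j + 1) := by
    have : (1 - ((j + 2 : ℕ) : ℤ)) = -((j + 1 : ℕ) : ℤ) := by push_cast; ring
    rw [this, zpow_neg, zpow_natCast, inv_pow]
  set t : ℝ := ((q : ℝ)⁻¹) ^ (j + 1) with ht
  have ht0 : 0 < t := by positivity
  have ht1 : t < 1 := pow_lt_one₀ hq0.le ((inv_natCast_le_half hq).trans_lt (by norm_num))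
    (by omega)
  have hlog := Real.hasSum_pow_div_log_of_abs_lt_one (x := t) (by rw [abs_of_pos ht0]; exact ht1)
  rw [hz, one_div, Real.log_inv, ← hlog.tsum_eq, ← tsum_mul_left,
    ← (hs.prod_factor (j + 2)).sum_add_tsum_nat_add 1]
  have h1 : ∑ m ∈ Finset.range 1, defectTerm q (j + 2, m) = 0 := by simp [defectTerm]
  rw [h1, zero_add]
  refine tsum_congr fun m => ?_
  rw [defectTerm, if_pos ⟨by omega, by omega⟩]
  have e : (j + 2 - 1) * (m + 1) = (j + 1) * (m + 1) := by simp
  simp only [e]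
  rw [pow_mul, ← ht]
  push_cast
  have h2 : (j : ℝ) + 2 ≠ 0 := by positivity
  have h3 : (m : ℝ) + 1 ≠ 0 := by positivity
  field_simp

/-- The absolutely convergent double series is regrouped along `k m = d`; the infinite fibre over `d
= 0` contains only zero terms. -/
theorem hasSum_irrDefect (F : Type*) [Field F] [Fintype F] :
    HasSum (irrDefect F) (polyR (Fintype.card F)) := by
  have hq : 2 ≤ Fintype.card F := Fintype.one_lt_card
  have h := (summable_defectTerm hq).hasSum.tsum_fiberwise fun x : ℕ × ℕ => x.1 * x.2
  rw [tsum_defectTerm hq] at h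
  refine h.congr_fun fun d => ?_
  rcases Nat.eq_zero_or_pos d with rfl | hd
  · rw [irrDefect_zero]
    have : ∀ x : (fun x : ℕ × ℕ => x.1 * x.2) ⁻¹' {0},
        defectTerm (Fintype.card F) x = 0 := by
      rintro ⟨x, hx⟩
      have hx : x.1 * x.2 = 0 := hx
      rw [defectTerm, if_neg]
      rintro ⟨h1, h2⟩
      exact (Nat.mul_pos (two_pos.trans_le h1) h2).ne' hx
    simp [this]
  · have hset : (fun x : ℕ × ℕ => x.1 * x.2) ⁻¹' {d} = (d.divisorsAntidiagonal : Set (ℕ × ℕ)) := by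
      ext x; simp [hd.ne']
    rw [hset, Finset.tsum_subtype', sum_defectTerm F hd]

/-! ### Sums over irreducibles, grouped by degree. -/

section FiberSums

set_option linter.unusedSectionVars false

variable (F : Type*) [Field F] [Fintype F]

theorem summable_deg_iff {φ : ℕ → ℝ} (hφ : ∀ d, 0 ≤ φ d) :
    (Summable fun Q : MonicIrreducible F => φ Q.deg) ↔ Summable fun d => irrCount F d * φ d := by
  have h0 : ∀ x, 0 ≤ ((fun Q : MonicIrreducible F => φ Q.deg) ∘ Equiv.sigmaFiberEquiv deg) x :=
    fun _ => hφ _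
  rw [← (Equiv.sigmaFiberEquiv (deg : MonicIrreducible F → ℕ)).summable_iff,
    summable_sigma_of_nonneg h0]
  have hfib : ∀ (d : ℕ) (Q : {Q : MonicIrreducible F // Q.deg = d}),
      ((fun Q : MonicIrreducible F => φ Q.deg) ∘ Equiv.sigmaFiberEquiv deg) ⟨d, Q⟩ = φ d := by
    rintro d ⟨Q, rfl⟩; rfl
  simp only [hfib, tsum_const, nsmul_eq_mul]
  constructor
  · exact fun h => h.2
  · refine fun h => ⟨fun d => ?_, h⟩
    have : Finite {Q : MonicIrreducible F // Q.deg = d} := finite_fiber_deg F d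
    exact Summable.of_finite

theorem tsum_deg {φ : ℕ → ℂ} (h : Summable fun Q : MonicIrreducible F => φ Q.deg) :
    HasSum (fun d => irrCount F d * φ d) (∑' Q : MonicIrreducible F, φ Q.deg) := by
  refine (h.hasSum.tsum_fiberwise deg).congr_fun fun d => ?_
  have hfib : ∀ Q : (deg : MonicIrreducible F → ℕ) ⁻¹' {d}, φ (Q : MonicIrreducible F).deg = φ d :=
    fun Q => congrArg φ Q.2
  simp only [hfib, tsum_const, nsmul_eq_mul]
  rfl

theorem summable_pow_deg {r : ℝ} (hr : 0 ≤ r) (hr1 : Fintype.card F * r < 1) :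
    Summable fun Q : MonicIrreducible F => r ^ Q.deg := by
  rw [summable_deg_iff F (φ := fun d => r ^ d) fun d => by positivity]
  refine Summable.of_nonneg_of_le (fun d => by positivity) (fun d => ?_)
    (summable_geometric_of_lt_one (by positivity) hr1)
  rw [mul_pow]
  gcongr
  exact_mod_cast irrCount_le F d

end FiberSums

/-! ### Expansion of the generating function over squarefree products. -/

section Squarefree

variable (F : Type*) [Field F]

/-- The degree of the product of a finite set of monic irreducible polynomials. -/
noncomputable def degSum (A : Finset (MonicIrreducible F)) : ℕ := ∑ Q ∈ A, Q.deg

variable {F}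

theorem monic_prod_irreducible (A : Finset (MonicIrreducible F)) :
    (∏ Q ∈ A, (Q : F[X])).Monic := monic_prod_of_monic _ _ fun Q _ => Q.2.1

theorem natDegree_prod_irreducible (A : Finset (MonicIrreducible F)) :
    (∏ Q ∈ A, (Q : F[X])).natDegree = degSum F A :=
  natDegree_prod_of_monic _ _ fun Q _ => Q.2.1

theorem isCoprime_of_ne {Q Q' : MonicIrreducible F} (h : Q ≠ Q') :
    IsCoprime (Q : F[X]) (Q' : F[X]) := by
  rw [Q.2.2.coprime_iff_not_dvd]
  intro hd
  exact h (Subtype.ext (eq_of_monic_of_associated Q.2.1 Q'.2.1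
    (Q.2.2.associated_of_dvd Q'.2.2 hd)))

theorem prod_irreducible_dvd_iff (A : Finset (MonicIrreducible F)) (f : F[X]) :
    (∏ Q ∈ A, (Q : F[X])) ∣ f ↔ ∀ Q ∈ A, (Q : F[X]) ∣ f :=
  ⟨fun h _ hQ => (Finset.dvd_prod_of_mem (fun Q : MonicIrreducible F => (Q : F[X])) hQ).trans h,
    fun h => Finset.prod_dvd_of_coprime (fun _ _ _ _ hne => isCoprime_of_ne hne) h⟩

variable [Fintype F]

theorem finite_deg_le (n : ℕ) : {Q : MonicIrreducible F | Q.deg ≤ n}.Finite := by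
  have h : {Q : MonicIrreducible F | Q.deg ≤ n}
      = ⋃ d ∈ Finset.range (n + 1), (deg : MonicIrreducible F → ℕ) ⁻¹' {d} := by
    ext Q; simp
  rw [h]
  refine Set.Finite.biUnion (Finset.finite_toSet _) fun d _ => ?_
  have := finite_fiber_deg F d
  exact Set.toFinite _

theorem finite_degSum_le (n : ℕ) : {A : Finset (MonicIrreducible F) | degSum F A ≤ n}.Finite := by
  refine ((finite_deg_le (F := F) n).toFinset.powerset.finite_toSet).subset fun A hA => ?_
  rw [Finset.mem_coe, Finset.mem_powerset]
  intro Q hQ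
  rw [Set.Finite.mem_toFinset]
  exact (Finset.single_le_sum (f := deg) (fun _ _ => Nat.zero_le _) hQ).trans hA

theorem finite_irreducible_dvd {f : F[X]} (hf : f ≠ 0) :
    {Q : MonicIrreducible F | (Q : F[X]) ∣ f}.Finite :=
  (finite_deg_le f.natDegree).subset fun _ hQ => natDegree_le_of_dvd hQ hf

theorem numIrreducibleDivisors_eq_card {f : F[X]} (hf : f ≠ 0) :
    numIrreducibleDivisors f = (finite_irreducible_dvd hf).toFinset.card := by
  rw [← Set.ncard_eq_toFinset_card _ (finite_irreducible_dvd hf), numIrreducibleDivisors,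
    ← Set.ncard_image_of_injective _ Subtype.val_injective]
  congr 1
  ext Q
  simp
  tauto

theorem finite_monic_natDegree_set (n : ℕ) : {p : F[X] | p.Monic ∧ p.natDegree = n}.Finite := by
  have := finite_monic_natDegree F n
  refine (Set.finite_range (Subtype.val : {p : F[X] // p.Monic ∧ p.natDegree = n} → F[X])).subset ?_
  exact fun p hp => ⟨⟨p, hp⟩, rfl⟩

variable (F) in
/-- The finite set of monic polynomials of degree `n`. -/
noncomputable def monicFinset (n : ℕ) : Finset F[X] :=
  (finite_monic_natDegree_set (F := F) n).toFinset

theorem mem_monicFinset {n : ℕ} {p : F[X]} : p ∈ monicFinset F n ↔ p.Monic ∧ p.natDegree = n := by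
  simp [monicFinset]

theorem coe_monicFinset (n : ℕ) :
    (monicFinset F n : Set F[X]) = {p : F[X] | p.Monic ∧ p.natDegree = n} := by
  simp [monicFinset]

theorem card_monicFinset (n : ℕ) : (monicFinset F n).card = Fintype.card F ^ n := by
  rw [← card_monic_natDegree, ← Nat.card_eq_finsetCard]
  exact Nat.card_congr (Equiv.subtypeEquivRight fun p => mem_monicFinset)

open Classical in
theorem card_monicFinset_dvd {p : F[X]} (hp : p.Monic) {n : ℕ} (hn : p.natDegree ≤ n) :
    ((monicFinset F n).filter (p ∣ ·)).card = Fintype.card F ^ (n - p.natDegree) := by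
  rw [← card_monicFinset]
  symm
  refine Finset.card_bij (fun g _ => p * g) (fun g hg => ?_) (fun g _ g' _ h => ?_) fun f hf => ?_
  · rw [mem_monicFinset] at hg
    rw [Finset.mem_filter, mem_monicFinset, hp.natDegree_mul hg.1, hg.2]
    exact ⟨⟨hp.mul hg.1, by omega⟩, dvd_mul_right _ _⟩
  · exact mul_left_cancel₀ hp.ne_zero h
  · rw [Finset.mem_filter, mem_monicFinset] at hf
    obtain ⟨⟨hfm, hfd⟩, g, rfl⟩ := hf
    have hg : g.Monic := hp.of_mul_monic_left hfm
    refine ⟨g, ?_, rfl⟩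
    rw [hp.natDegree_mul hg] at hfd
    exact mem_monicFinset.2 ⟨hg, by omega⟩

variable (F) in
/-- The coefficient of `u ^ k` in `∏ (1 + z (u / q) ^ deg Q)`. -/
noncomputable def sqfreeCoeff (z : ℂ) (k : ℕ) : ℂ :=
  ∑' A : (degSum F) ⁻¹' {k}, z ^ (A : Finset (MonicIrreducible F)).card / (Fintype.card F : ℂ) ^ k

-- The binomial expansion runs over subsets of the irreducible divisors of `f`. Distinct
-- irreducibles being coprime, such a subset is detected by divisibility of `f` by its product; the
-- degree bound makes the index set the same for all `f`.
open Classical in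
theorem pow_numIrreducibleDivisors {n : ℕ} {f : F[X]} (hf : f ∈ monicFinset F n) (z : ℂ) :
    (z + 1) ^ numIrreducibleDivisors f =
      ∑ A ∈ (finite_degSum_le (F := F) n).toFinset,
        if (∏ Q ∈ A, (Q : F[X])) ∣ f then z ^ A.card else 0 := by
  have hf' := mem_monicFinset.1 hf
  have hf0 : f ≠ 0 := hf'.1.ne_zero
  rw [numIrreducibleDivisors_eq_card hf0, ← Finset.sum_pow_mul_eq_add_pow, ← Finset.sum_filter]
  simp only [one_pow, mul_one]
  refine Finset.sum_congr ?_ fun _ _ => rfl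
  ext A
  rw [Finset.mem_powerset, Finset.mem_filter, Set.Finite.mem_toFinset, prod_irreducible_dvd_iff,
    Set.mem_ofPred_eq]
  constructor
  · intro h
    have h' : ∀ Q ∈ A, (Q : F[X]) ∣ f := fun Q hQ => by simpa using h hQ
    refine ⟨?_, h'⟩
    rw [← natDegree_prod_irreducible, ← hf'.2]
    exact natDegree_le_of_dvd ((prod_irreducible_dvd_iff A f).2 h') hf0
  · rintro ⟨-, h⟩ Q hQ
    simpa using h Q hQ

open Classical in
theorem sum_pow_numIrreducibleDivisors (n : ℕ) (z : ℂ) :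
    ∑ f ∈ monicFinset F n, (z + 1) ^ numIrreducibleDivisors f =
      (Fintype.card F : ℂ) ^ n * ∑ k ∈ Finset.range (n + 1), sqfreeCoeff F z k := by
  have hq : (Fintype.card F : ℂ) ≠ 0 := by exact_mod_cast Fintype.card_ne_zero
  set S := (finite_degSum_le (F := F) n).toFinset with hS
  have hmem : ∀ A, A ∈ S ↔ degSum F A ≤ n := fun A => by simp [hS]
  rw [Finset.sum_congr rfl fun f hf => pow_numIrreducibleDivisors hf z, Finset.sum_comm]
  have h1 : ∀ A ∈ S, (∑ f ∈ monicFinset F n,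
      if (∏ Q ∈ A, (Q : F[X])) ∣ f then z ^ A.card else 0)
        = (Fintype.card F : ℂ) ^ (n - degSum F A) * z ^ A.card := by
    intro A hA
    rw [← Finset.sum_filter, Finset.sum_const, card_monicFinset_dvd (monic_prod_irreducible A)
      (by rw [natDegree_prod_irreducible]; exact (hmem A).1 hA), natDegree_prod_irreducible,
      nsmul_eq_mul, Nat.cast_pow]
  rw [Finset.sum_congr rfl h1, ← Finset.sum_fiberwise_of_maps_to (t := Finset.range (n + 1))
    (g := degSum F) (fun A hA => Finset.mem_range_succ_iff.2 ((hmem A).1 hA)), Finset.mul_sum]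
  refine Finset.sum_congr rfl fun k hk => ?_
  have hk : k ≤ n := Finset.mem_range_succ_iff.1 hk
  have hset : (degSum F) ⁻¹' {k} = ((S.filter (degSum F · = k) : Finset _) : Set _) := by
    ext A
    simp only [Set.mem_preimage, Set.mem_singleton_iff, Finset.coe_filter, hmem, Set.mem_ofPred_eq]
    constructor
    · exact fun h => ⟨h.trans_le hk, h⟩
    · exact fun h => h.2
  rw [sqfreeCoeff, hset, Finset.tsum_subtype' _ fun A : Finset (MonicIrreducible F) =>
    z ^ A.card / (Fintype.card F : ℂ) ^ k, Finset.mul_sum]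
  refine Finset.sum_congr rfl fun A hA => ?_
  rw [(Finset.mem_filter.1 hA).2]
  obtain ⟨m, rfl⟩ := Nat.exists_eq_add_of_le hk
  rw [Nat.add_sub_cancel_left, pow_add]
  field_simp

theorem summable_norm_mul_pow_deg (z : ℂ) {u : ℂ} (hu : ‖u‖ < 1) :
    Summable fun Q : MonicIrreducible F => ‖z * (u / Fintype.card F) ^ Q.deg‖ := by
  have hq : (0 : ℝ) < Fintype.card F := by exact_mod_cast Fintype.card_pos
  have h := summable_pow_deg F (r := ‖u‖ / Fintype.card F) (by positivity)
    (by rw [mul_div_cancel₀ _ hq.ne']; exact hu)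
  refine (h.mul_left ‖z‖).congr fun Q => ?_
  simp

/-- The Euler product is expanded over finite sets of irreducibles, then grouped by total degree. -/
theorem hasSum_sqfreeCoeff (z : ℂ) {u : ℂ} (hu : ‖u‖ < 1) :
    HasSum (fun k => sqfreeCoeff F z k * u ^ k)
      (∏' Q : MonicIrreducible F, (1 + z * (u / Fintype.card F) ^ Q.deg)) := by
  have hs := summable_finsetProd_of_summable_norm (summable_norm_mul_pow_deg (F := F) z hu)
  rw [tprod_one_add hs]
  refine (hs.hasSum.tsum_fiberwise (degSum F)).congr_fun fun k => ?_
  rw [sqfreeCoeff, ← tsum_mul_right]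
  refine tsum_congr fun A => ?_
  have hA : degSum F (A : Finset (MonicIrreducible F)) = k := A.2
  rw [Finset.prod_mul_distrib, Finset.prod_const, Finset.prod_pow_eq_pow_sum]
  change _ = z ^ _ * _ ^ degSum F _
  rw [hA, div_pow]
  ring

end Squarefree

/-! ### Factorisation of the Euler product beyond the unit disc. -/

section EulerProduct

variable (F : Type*) [Field F] [Fintype F]

/-- The power series `∑ (N_d / q ^ d - 1 / d) u ^ d`. -/
noncomputable def defectSeries (u : ℂ) : ℂ := ∑' d : ℕ, (irrDefect F d : ℂ) * u ^ d

/-- The product `∏ (1 + z x_Q) exp (-z x_Q)`, where `x_Q = (u / q) ^ deg Q`. -/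
noncomputable def primeProduct (z u : ℂ) : ℂ :=
  ∏' Q : MonicIrreducible F, bernoulliFactor (z * (u / Fintype.card F) ^ Q.deg)

/-- The analytic factor `∏ (1 + z x_Q) / (1 - u) ^ (-z)`, where `x_Q = (u / q) ^ deg Q`. -/
noncomputable def analyticFactor (z u : ℂ) : ℂ :=
  primeProduct F z u * Complex.exp (z * defectSeries F u)

/-- The radius `5/4` exceeds 1 while `3/4 * 5/4` stays below 1. -/
theorem norm_irrDefect_mul_pow_le {u : ℂ} (hu : ‖u‖ ≤ 5 / 4) (d : ℕ) :
    ‖(irrDefect F d : ℂ) * u ^ d‖ ≤ (15 / 16 : ℝ) ^ d := by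
  rw [norm_mul, norm_pow, Complex.norm_real, Real.norm_eq_abs]
  calc |irrDefect F d| * ‖u‖ ^ d ≤ (3 / 4 : ℝ) ^ d * (5 / 4) ^ d := by
        gcongr
        exact abs_irrDefect_le F d
    _ = (15 / 16 : ℝ) ^ d := by rw [← mul_pow]; norm_num

theorem summable_fifteen_sixteenths : Summable fun d : ℕ => (15 / 16 : ℝ) ^ d :=
  summable_geometric_of_lt_one (by norm_num) (by norm_num)

theorem hasSum_defectSeries {u : ℂ} (hu : ‖u‖ ≤ 5 / 4) :
    HasSum (fun d : ℕ => (irrDefect F d : ℂ) * u ^ d) (defectSeries F u) :=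
  (Summable.of_norm_bounded summable_fifteen_sixteenths
    (norm_irrDefect_mul_pow_le F hu)).hasSum

theorem norm_defectSeries_le {u : ℂ} (hu : ‖u‖ ≤ 5 / 4) : ‖defectSeries F u‖ ≤ 16 := by
  have h := tsum_of_norm_bounded summable_fifteen_sixteenths.hasSum (norm_irrDefect_mul_pow_le F hu)
  rw [tsum_geometric_of_lt_one (by norm_num) (by norm_num)] at h
  norm_num at h
  exact h

theorem differentiableOn_defectSeries :
    DifferentiableOn ℂ (defectSeries F) (Metric.ball 0 (5 / 4)) :=
  Complex.differentiableOn_tsum_of_summable_norm summable_fifteen_sixteenths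
    (fun d => by fun_prop) Metric.isOpen_ball fun d u hu =>
      norm_irrDefect_mul_pow_le F (mem_ball_zero_iff.1 hu).le d

theorem defectSeries_one : defectSeries F 1 = polyR (Fintype.card F) := by
  have h := Complex.hasSum_ofReal.2 (hasSum_irrDefect F)
  simpa [defectSeries] using h.tsum_eq

/-- A summable bound for the factors of `primeProduct`. -/
noncomputable def primeBound (R : ℝ) (Q : MonicIrreducible F) : ℝ :=
  ((1 + R) * Real.exp R + 1) * R ^ 2 * ((5 / 4 / (Fintype.card F : ℝ)) ^ 2) ^ Q.deg

/-- The quadratic error gains a factor `q`: with at most `q ^ d` irreducibles of degree `d`, the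
ratio is `25 / (16 q) < 1`, even for `q = 2`. -/
theorem summable_primeBound (R : ℝ) : Summable (primeBound F R) := by
  refine (summable_pow_deg F (by positivity) ?_).mul_left _
  have hq : (2 : ℝ) ≤ Fintype.card F := by exact_mod_cast Fintype.one_lt_card (α := F)
  have : (Fintype.card F : ℝ) * (5 / 4 / (Fintype.card F : ℝ)) ^ 2
      = 25 / 16 / Fintype.card F := by field_simp; norm_num
  rw [this, div_lt_one (by linarith)]
  linarith

theorem norm_bernoulliFactor_prime_sub_one_le {R : ℝ} {z u : ℂ} (hz : ‖z‖ ≤ R)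
    (hu : ‖u‖ ≤ 5 / 4) (Q : MonicIrreducible F) :
    ‖bernoulliFactor (z * (u / Fintype.card F) ^ Q.deg) - 1‖ ≤ primeBound F R Q := by
  have hR : 0 ≤ R := (norm_nonneg _).trans hz
  have hq : (2 : ℝ) ≤ Fintype.card F := by exact_mod_cast Fintype.one_lt_card (α := F)
  have hx : ‖(u / Fintype.card F) ^ Q.deg‖ ≤ (5 / 4 / (Fintype.card F : ℝ)) ^ Q.deg := by
    rw [norm_pow, norm_div, Complex.norm_natCast]; gcongr
  have hx1 : (5 / 4 / (Fintype.card F : ℝ)) ^ Q.deg ≤ 1 := by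
    refine pow_le_one₀ (by positivity) ?_
    rw [div_le_one (by linarith)]; linarith
  refine (norm_bernoulliFactor_sub_one_le (R := R) ?_).trans ?_
  · rw [norm_mul]
    calc _ ≤ R * 1 := by gcongr; exact hx.trans hx1
      _ = R := mul_one R
  · rw [primeBound, mul_assoc, norm_mul, mul_pow, ← pow_mul, mul_comm 2, pow_mul]
    gcongr

theorem summable_bernoulliFactor_prime (z : ℂ) {u : ℂ} (hu : ‖u‖ ≤ 5 / 4) :
    Summable fun Q : MonicIrreducible F =>
      ‖bernoulliFactor (z * (u / Fintype.card F) ^ Q.deg) - 1‖ :=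
  Summable.of_nonneg_of_le (fun _ => norm_nonneg _)
    (norm_bernoulliFactor_prime_sub_one_le F le_rfl hu) (summable_primeBound F _)

theorem norm_primeProduct_le {R : ℝ} {z u : ℂ} (hz : ‖z‖ ≤ R) (hu : ‖u‖ ≤ 5 / 4) :
    ‖primeProduct F z u‖ ≤ Real.exp (∑' Q, primeBound F R Q) := by
  have h := norm_tprod_one_add_le (summable_bernoulliFactor_prime F z hu)
  simp only [add_sub_cancel] at h
  refine h.trans (Real.exp_le_exp.2 ?_)
  exact (summable_bernoulliFactor_prime F z hu).tsum_le_tsum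
    (norm_bernoulliFactor_prime_sub_one_le F hz hu) (summable_primeBound F R)

theorem differentiableOn_primeProduct (z : ℂ) :
    DifferentiableOn ℂ (primeProduct F z) (Metric.ball 0 (5 / 4)) := by
  have h := differentiableOn_tprod_one_add (U := Metric.ball (0 : ℂ) (5 / 4)) Metric.isOpen_ball
    (f := fun (Q : MonicIrreducible F) u =>
      bernoulliFactor (z * (u / Fintype.card F) ^ Q.deg) - 1)
    (summable_primeBound F ‖z‖)
    (fun Q => ((differentiable_bernoulliFactor.comp (by fun_prop)).sub_const 1).differentiableOn)
    (fun Q u hu => norm_bernoulliFactor_prime_sub_one_le F le_rfl (mem_ball_zero_iff.1 hu).le Q)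
  simp only [add_sub_cancel] at h
  exact h

theorem norm_analyticFactor_le {R : ℝ} {z u : ℂ} (hz : ‖z‖ ≤ R) (hu : ‖u‖ ≤ 5 / 4) :
    ‖analyticFactor F z u‖ ≤ Real.exp (∑' Q, primeBound F R Q) * Real.exp (R * 16) := by
  rw [analyticFactor, norm_mul]
  gcongr
  · exact norm_primeProduct_le F hz hu
  · refine norm_exp_le_exp ?_
    rw [norm_mul]
    have := norm_defectSeries_le F hu
    have hR : 0 ≤ R := (norm_nonneg _).trans hz
    gcongr

theorem differentiableOn_analyticFactor (z : ℂ) :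
    DifferentiableOn ℂ (analyticFactor F z) (Metric.ball 0 (5 / 4)) :=
  (differentiableOn_primeProduct F z).mul ((differentiableOn_defectSeries F).const_mul z).cexp

/-- Splitting `N_d / q ^ d` into the defect and `1/d`, the second part sums to `-log (1 - u)`, the
source of the singularity at `u = 1`. -/
theorem tsum_prime_pow_deg {u : ℂ} (hu : ‖u‖ < 1) :
    HasSum (fun Q : MonicIrreducible F => (u / Fintype.card F) ^ Q.deg)
      (defectSeries F u - Complex.log (1 - u)) := by
  have hs : Summable fun Q : MonicIrreducible F => (u / Fintype.card F) ^ Q.deg := by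
    have := (summable_norm_mul_pow_deg (F := F) 1 hu).of_norm
    simpa using this
  have h1 := tsum_deg F (φ := fun d => (u / Fintype.card F) ^ d) hs
  have h2 := (hasSum_defectSeries F (u := u) (by linarith)).add
    (Complex.hasSum_taylorSeries_neg_log hu)
  have h3 : (fun d : ℕ => (irrCount F d : ℂ) * (u / Fintype.card F) ^ d)
      = fun d : ℕ => (irrDefect F d : ℂ) * u ^ d + u ^ d / d := by
    funext d
    rw [irrDefect, div_pow]
    push_cast
    ring
  rw [h3] at h1
  rw [sub_eq_add_neg, ← h1.unique h2]
  exact hs.hasSum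

theorem tprod_one_add_eq_analyticFactor_mul (z : ℂ) {u : ℂ} (hu : ‖u‖ < 1) :
    ∏' Q : MonicIrreducible F, (1 + z * (u / Fintype.card F) ^ Q.deg)
      = analyticFactor F z u * Complex.exp (-(z * Complex.log (1 - u))) := by
  have h1 := multipliable_one_add_of_summable (summable_norm_mul_pow_deg (F := F) z hu)
  have h2 := ((tsum_prime_pow_deg F hu).mul_left z).neg.cexp
  have h3 : primeProduct F z u
      = (∏' Q : MonicIrreducible F, (1 + z * (u / Fintype.card F) ^ Q.deg))
        * Complex.exp (-(z * (defectSeries F u - Complex.log (1 - u)))) :=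
    (h1.hasProd.mul h2).tprod_eq
  rw [analyticFactor, h3, mul_assoc, mul_assoc, ← Complex.exp_add, ← Complex.exp_add]
  have : -(z * (defectSeries F u - Complex.log (1 - u))) +
      (z * defectSeries F u + -(z * Complex.log (1 - u))) = 0 := by ring
  rw [this, Complex.exp_zero, mul_one]

/-- Partial summation is multiplication by `1 / (1 - u)`, which turns `(1 - u) ^ (-z)` into `(1 - u)
^ (-(z + 1))`. -/
theorem sum_convolution_risingCoeff (h : ℕ → ℂ) (z : ℂ) (n : ℕ) :
    ∑ j ∈ Finset.range (n + 1), ∑ k ∈ Finset.range (j + 1), h k * risingCoeff (z - 1) (j - k)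
      = ∑ k ∈ Finset.range (n + 1), h k * risingCoeff z (n - k) := by
  induction n with
  | zero => simp [risingCoeff_zero]
  | succ n ih =>
    rw [Finset.sum_range_succ, ih, Finset.sum_range_succ _ (n + 1), Finset.sum_range_succ _ (n + 1),
      ← add_assoc, ← Finset.sum_add_distrib]
    simp only [Nat.sub_self, risingCoeff_zero]
    congr 1
    refine Finset.sum_congr rfl fun k hk => ?_
    have hk : k ≤ n := Finset.mem_range_succ_iff.1 hk
    rw [Nat.succ_sub hk, risingCoeff_sub_one_succ, risingCoeff_succ]
    ring

theorem exists_convolution_coeffs (R : ℝ) :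
    ∃ M : ℝ, 0 ≤ M ∧ ∀ z : ℂ, ‖z‖ ≤ R → ∃ h : ℕ → ℂ,
      (∀ k, ‖h k‖ ≤ M * (5 / 6 : ℝ) ^ k) ∧ HasSum h (analyticFactor F z 1) ∧
      ∀ n, ∑ f ∈ monicFinset F n, (z + 1) ^ numIrreducibleDivisors f =
        (Fintype.card F : ℂ) ^ n *
          ∑ k ∈ Finset.range (n + 1), h k * risingCoeff z (n - k) := by
  refine ⟨Real.exp (∑' Q, primeBound F R Q) * Real.exp (R * 16), by positivity, fun z hz => ?_⟩
  -- Any radius strictly between 1 and `5/4` would do: the Taylor series must converge at `u = 1`,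
  -- with geometric decay of its coefficients.
  have hsub : Metric.closedBall (0 : ℂ) (6 / 5) ⊆ Metric.ball 0 (5 / 4) :=
    Metric.closedBall_subset_ball (by norm_num)
  obtain ⟨h, hsum, hbound⟩ := exists_taylor_bound (ρ := 6 / 5) (by norm_num)
    ((differentiableOn_analyticFactor F z).mono hsub)
    (fun u hu => norm_analyticFactor_le F hz (mem_ball_zero_iff.1 (hsub hu)).le)
  refine ⟨h, fun k => ?_, by simpa using hsum 1 (by norm_num), fun n => ?_⟩
  · have := hbound k
    rwa [inv_div] at this
  · have hcoeff : sqfreeCoeff F z =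
        fun n => ∑ k ∈ Finset.range (n + 1), h k * risingCoeff (z - 1) (n - k) := by
      refine coeff_eq_of_hasSum_ball (fun u hu => hasSum_sqfreeCoeff z hu) fun u hu => ?_
      rw [tprod_one_add_eq_analyticFactor_mul F z hu]
      exact hasSum_ball_mul (F := analyticFactor F z)
        (G := fun u => Complex.exp (-(z * Complex.log (1 - u))))
        (fun u hu => hsum u (hu.trans (by norm_num))) (fun u hu => hasSum_risingCoeff z hu) hu
    rw [sum_pow_numIrreducibleDivisors, hcoeff, sum_convolution_risingCoeff]

end EulerProduct

/-! ### Transfer of the asymptotics through the convolution. -/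

theorem rpow_le_pow_mul_rpow {m n a c : ℝ} {B : ℕ} (hm : 0 < m) (hmn : m ≤ n) (hn : n ≤ a * m)
    (hc : -(B : ℝ) ≤ c) : m ^ c ≤ a ^ B * n ^ c := by
  have hn0 : 0 < n := hm.trans_le hmn
  have e : m ^ c = (m / n) ^ c * n ^ c := by
    rw [Real.div_rpow hm.le hn0.le, div_mul_cancel₀ _ (Real.rpow_pos_of_pos hn0 c).ne']
  rw [e]
  gcongr
  calc (m / n) ^ c ≤ (m / n) ^ (-(B : ℝ)) :=
        Real.rpow_le_rpow_of_exponent_ge (by positivity) ((div_le_one hn0).2 hmn) hc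
    _ = (n / m) ^ B := by
        rw [Real.rpow_neg (by positivity), Real.rpow_natCast, ← inv_pow, inv_div]
    _ ≤ a ^ B := by
        gcongr
        rwa [div_le_iff₀ hm]

/-- A unit shift of the index gains a factor `1/n`, so a shift by `k` does too, at a cost polynomial
in `k` that the decay of the Taylor coefficients can afford. -/
theorem norm_risingCoeff_sub_le {R C : ℝ} {z : ℂ} (hz : ‖z‖ ≤ R) (hC : 0 ≤ C)
    (hb : ∀ n : ℕ, ‖risingCoeff z n‖ ≤ C * ((n : ℝ) + 1) ^ z.re) {B : ℕ} (hB : R + 1 ≤ B)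
    {n k : ℕ} (hk : k ≤ n) :
    ‖risingCoeff z (n - k) - risingCoeff z n‖
      ≤ C * R * (k * ((k : ℝ) + 1) ^ B) * (n : ℝ) ^ (z.re - 1) := by
  have hR : 0 ≤ R := (norm_nonneg _).trans hz
  induction k with
  | zero => simp
  | succ k ih =>
    obtain ⟨m, rfl⟩ : ∃ m, n = m + k + 1 := ⟨n - k - 1, by omega⟩
    have e1 : m + k + 1 - (k + 1) = m := by omega
    have e2 : m + k + 1 - k = m + 1 := by omega
    have ih := ih (by omega)
    rw [e2] at ih
    rw [e1]
    have hm : (0 : ℝ) ≤ m := by positivity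
    have hk0 : (0 : ℝ) ≤ k := by positivity
    have hstep : ‖risingCoeff z m - risingCoeff z (m + 1)‖
        ≤ C * R * ((k : ℝ) + 1) ^ B * ((m + k + 1 : ℕ) : ℝ) ^ (z.re - 1) := by
      have e3 : risingCoeff z m - risingCoeff z (m + 1) = -(risingCoeff z m * (z / (m + 1))) := by
        rw [risingCoeff_succ]; ring
      have e4 : ‖z / ((m : ℂ) + 1)‖ = ‖z‖ / ((m : ℝ) + 1) := by
        rw [norm_div]
        congr 1
        rw [← Nat.cast_succ, Complex.norm_natCast, Nat.cast_succ]
      have e5 : ((m : ℝ) + 1) ^ z.re / ((m : ℝ) + 1) = ((m : ℝ) + 1) ^ (z.re - 1) := by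
        rw [Real.rpow_sub_one (by positivity)]
      have e6 : ((m : ℝ) + 1) ^ (z.re - 1)
          ≤ ((k : ℝ) + 1) ^ B * ((m + k + 1 : ℕ) : ℝ) ^ (z.re - 1) := by
        -- Uses `m + k + 1 ≤ (k + 1) (m + 1)`; the choice `B ≥ R + 1` covers negative exponents, as
        -- `Re z - 1 ≥ -B`.
        refine rpow_le_pow_mul_rpow (by positivity) ?_ ?_ ?_
        · push_cast; linarith
        · push_cast; nlinarith
        · have := (abs_le.1 ((Complex.abs_re_le_norm z).trans hz)).1
          linarith
      rw [e3, norm_neg, norm_mul, e4]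
      calc ‖risingCoeff z m‖ * (‖z‖ / ((m : ℝ) + 1))
          ≤ (C * ((m : ℝ) + 1) ^ z.re) * (R / ((m : ℝ) + 1)) := by
            gcongr
            exact hb m
        _ = C * R * (((m : ℝ) + 1) ^ z.re / ((m : ℝ) + 1)) := by ring
        _ ≤ C * R * (((k : ℝ) + 1) ^ B * ((m + k + 1 : ℕ) : ℝ) ^ (z.re - 1)) := by
            rw [e5]; gcongr
        _ = _ := by ring
    have htri := norm_add_le (risingCoeff z m - risingCoeff z (m + 1))
      (risingCoeff z (m + 1) - risingCoeff z (m + k + 1))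
    rw [sub_add_sub_cancel] at htri
    calc _ ≤ C * R * ((k : ℝ) + 1) ^ B * ((m + k + 1 : ℕ) : ℝ) ^ (z.re - 1)
          + C * R * (k * ((k : ℝ) + 1) ^ B) * ((m + k + 1 : ℕ) : ℝ) ^ (z.re - 1) :=
          htri.trans (add_le_add hstep ih)
      _ = C * R * (((k + 1 : ℕ) : ℝ) * ((k : ℝ) + 1) ^ B)
          * ((m + k + 1 : ℕ) : ℝ) ^ (z.re - 1) := by push_cast; ring
      _ ≤ _ := by
        gcongr
        linarith

theorem summable_pow_mul_five_sixths (B : ℕ) :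
    Summable fun k : ℕ => ((k : ℝ) + 1) ^ B * (5 / 6 : ℝ) ^ k := by
  have h := (summable_nat_add_iff 1).2
    (summable_pow_mul_geometric_of_norm_lt_one B (r := (5 / 6 : ℝ)) (by norm_num))
  refine (h.mul_left (6 / 5)).congr fun k => ?_
  push_cast
  rw [pow_succ (5 / 6 : ℝ)]
  ring

theorem norm_exp_neg_mul_log (z : ℂ) {n : ℕ} (hn : 1 ≤ n) :
    ‖Complex.exp (-(z * (Real.log n : ℝ)))‖ = (n : ℝ) ^ (-z.re) := by
  have hn' : (0 : ℝ) < n := by exact_mod_cast hn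
  rw [Complex.norm_exp, Real.rpow_def_of_pos hn', Complex.neg_re, Complex.re_mul_ofReal]
  congr 1; ring

theorem exists_convolution_rate (F : Type*) [Field F] [Fintype F] (R : ℝ) :
    ∃ C : ℝ, 0 ≤ C ∧ ∀ z : ℂ, ‖z‖ ≤ R → ∀ n : ℕ, 1 ≤ n →
      ‖(∑ f ∈ monicFinset F n, (z + 1) ^ numIrreducibleDivisors f) / (Fintype.card F : ℂ) ^ n *
          Complex.exp (-(z * (Real.log n : ℝ))) - analyticFactor F z 1 * risingLimit z‖ ≤ C / n := by
  rcases lt_or_ge R 0 with hR | hR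
  · exact ⟨0, le_rfl, fun z hz => absurd ((norm_nonneg z).trans hz) (not_le.2 hR)⟩
  obtain ⟨C, hC, hrise⟩ := exists_risingCoeff_bounds R
  obtain ⟨M, hM, hcoef⟩ := exists_convolution_coeffs F R
  obtain ⟨B, hB⟩ := exists_nat_ge (R + 1)
  set D := ∑' k : ℕ, ((k : ℝ) + 1) ^ (B + 1) * (5 / 6 : ℝ) ^ k with hD
  have hD0 : 0 ≤ D := tsum_nonneg fun k => by positivity
  refine ⟨M * (C * R + C) * D, by positivity, fun z hz n hn => ?_⟩
  obtain ⟨hL, hb, hrate⟩ := hrise z hz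
  obtain ⟨h, hh, hsum, hgen⟩ := hcoef z hz
  have hq : (Fintype.card F : ℂ) ^ n ≠ 0 := pow_ne_zero _ (by exact_mod_cast Fintype.card_ne_zero)
  have hn' : (1 : ℝ) ≤ n := by exact_mod_cast hn
  rw [hgen, mul_div_cancel_left₀ _ hq]
  set e := Complex.exp (-(z * (Real.log n : ℝ))) with he
  -- Extending the finite convolution by zero lets it be compared termwise with the full series `∑ h
  -- k = analyticFactor F z 1`.
  set t : ℕ → ℂ := fun k => h k * ((if k ≤ n then risingCoeff z (n - k) * e else 0) - risingLimit z)
    with ht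
  have hfin : HasSum (fun k => h k * (if k ≤ n then risingCoeff z (n - k) * e else 0))
      ((∑ k ∈ Finset.range (n + 1), h k * risingCoeff z (n - k)) * e) := by
    have h1 : HasSum (fun k => h k * (if k ≤ n then risingCoeff z (n - k) * e else 0))
        (∑ k ∈ Finset.range (n + 1), h k * (if k ≤ n then risingCoeff z (n - k) * e else 0)) :=
      hasSum_sum_of_ne_finset_zero fun k hk => by
        rw [Finset.mem_range_succ_iff] at hk
        rw [if_neg hk, mul_zero]
    convert! h1 using 1
    rw [Finset.sum_mul]
    refine Finset.sum_congr rfl fun k hk => ?_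
    rw [if_pos (Finset.mem_range_succ_iff.1 hk), mul_assoc]
  have hts : HasSum t ((∑ k ∈ Finset.range (n + 1), h k * risingCoeff z (n - k)) * e
      - analyticFactor F z 1 * risingLimit z) := by
    refine (hfin.sub (hsum.mul_right _)).congr_fun fun k => ?_
    rw [ht]; ring
  have hbound : ∀ k, ‖t k‖ ≤ M * (C * R + C) / n * (((k : ℝ) + 1) ^ (B + 1) * (5 / 6 : ℝ) ^ k) := by
    intro k
    have hk0 : (0 : ℝ) ≤ k := by positivity
    have h1 : ‖(if k ≤ n then risingCoeff z (n - k) * e else 0) - risingLimit z‖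
        ≤ (C * R + C) / n * ((k : ℝ) + 1) ^ (B + 1) := by
      have hone : (1 : ℝ) ≤ ((k : ℝ) + 1) ^ (B + 1) := one_le_pow₀ (by linarith)
      split_ifs with hk
      · have h2 : ‖(risingCoeff z (n - k) - risingCoeff z n) * e‖
            ≤ C * R / n * ((k : ℝ) + 1) ^ (B + 1) := by
          rw [norm_mul, he, norm_exp_neg_mul_log z hn]
          have hn1 : (n : ℝ) ^ (z.re - 1) * (n : ℝ) ^ (-z.re) = 1 / n := by
            rw [← Real.rpow_add (by linarith), one_div, ← Real.rpow_neg_one]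
            congr 1; ring
          calc _ ≤ C * R * (k * ((k : ℝ) + 1) ^ B) * (n : ℝ) ^ (z.re - 1) * (n : ℝ) ^ (-z.re) := by
                gcongr
                exact norm_risingCoeff_sub_le hz hC hb hB hk
            _ = C * R * (k * ((k : ℝ) + 1) ^ B) * (1 / n) := by rw [mul_assoc, hn1]
            _ ≤ C * R * (((k : ℝ) + 1) * ((k : ℝ) + 1) ^ B) * (1 / n) := by
                gcongr; linarith
            _ = _ := by ring
        have h3 : C / n ≤ C / n * ((k : ℝ) + 1) ^ (B + 1) :=
          le_mul_of_one_le_right (by positivity) hone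
        have h4 : risingCoeff z (n - k) * e - risingLimit z
            = (risingCoeff z (n - k) - risingCoeff z n) * e
              + (risingCoeff z n * e - risingLimit z) := by ring
        rw [h4]
        calc _ ≤ C * R / n * ((k : ℝ) + 1) ^ (B + 1) + C / n * ((k : ℝ) + 1) ^ (B + 1) :=
              (norm_add_le _ _).trans (add_le_add h2 ((hrate n hn).trans h3))
          _ = _ := by ring
      -- Beyond the range `k ≤ n` only the limit remains; there the polynomial weight in `k` already
      -- dominates `n`, which supplies the factor `1/n`.
      · have hk' : (n : ℝ) ≤ (k : ℝ) + 1 := by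
          have : n ≤ k + 1 := by omega
          exact_mod_cast this
        rw [zero_sub, norm_neg]
        have hpow : (n : ℝ) ≤ ((k : ℝ) + 1) ^ (B + 1) :=
          hk'.trans (le_self_pow₀ (by linarith) (by omega))
        calc ‖risingLimit z‖ ≤ C := hL
          _ ≤ C * R + C := le_add_of_nonneg_left (by positivity)
          _ = (C * R + C) / n * n := by field_simp
          _ ≤ _ := by gcongr
    rw [ht, norm_mul]
    calc _ ≤ M * (5 / 6 : ℝ) ^ k * ((C * R + C) / n * ((k : ℝ) + 1) ^ (B + 1)) := by
          gcongr
          exact hh k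
      _ = _ := by ring
  have hfinal := tsum_of_norm_bounded
    ((summable_pow_mul_five_sixths (B + 1)).hasSum.mul_left (M * (C * R + C) / n)) hbound
  rw [hts.tsum_eq, ← hD] at hfinal
  exact hfinal.trans_eq (by ring)

/-! ### Identification of the limit with the residue of the alphabet. -/

section Residue

variable (F : Type*) [Field F] [Fintype F]

theorem bernoulliResidue_polyAlphabet (z : ℂ) :
    bernoulliResidue (polyAlphabet F) z = gammaProduct z * primeProduct F z 1 := by
  have e1 : ∀ k : ℕ, bernoulliFactor ((polyAlphabet F (Sum.inl k) : ℂ) * z)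
      = bernoulliFactor (z / (k + 1)) := fun k => by
    have h : polyAlphabet F (Sum.inl k) = 1 / ((k : ℝ) + 1) := rfl
    rw [h]; push_cast
    rw [one_div_mul_eq_div]
  have e2 : ∀ Q : MonicIrreducible F, bernoulliFactor ((polyAlphabet F (Sum.inr Q) : ℂ) * z)
      = bernoulliFactor (z * (1 / Fintype.card F) ^ Q.deg) := fun Q => by
    have h : polyAlphabet F (Sum.inr Q) = 1 / (Fintype.card F : ℝ) ^ Q.deg := rfl
    rw [h]; push_cast
    rw [mul_comm, one_div_pow]
  have h1 : Multipliable fun k : ℕ => bernoulliFactor ((polyAlphabet F (Sum.inl k) : ℂ) * z) := by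
    simp only [e1]
    exact multipliable_bernoulliFactor_div z 0
  have h2 : Multipliable fun Q : MonicIrreducible F =>
      bernoulliFactor ((polyAlphabet F (Sum.inr Q) : ℂ) * z) := by
    have h := multipliable_one_add_of_summable
      (summable_bernoulliFactor_prime F z (u := 1) (by norm_num))
    simp only [add_sub_cancel] at h
    simp only [e2]
    exact h
  rw [bernoulliResidue_eq_tprod, gammaProduct, primeProduct, ← tprod_congr e1, ← tprod_congr e2]
  exact Multipliable.tprod_sum h1 h2

theorem summable_sq_polyAlphabet : Summable fun i => polyAlphabet F i ^ 2 := by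
  refine Summable.sum _ ?_ ?_
  · refine (summable_inv_sq_shift 0).congr fun k => ?_
    simp [polyAlphabet]
  · have hq : (2 : ℝ) ≤ Fintype.card F := by exact_mod_cast Fintype.one_lt_card (α := F)
    have h := summable_pow_deg F (r := ((Fintype.card F : ℝ)⁻¹) ^ 2) (by positivity) (by
      have : (Fintype.card F : ℝ) * ((Fintype.card F : ℝ)⁻¹) ^ 2 = (Fintype.card F : ℝ)⁻¹ := by
        field_simp
      rw [this]
      exact inv_lt_one_of_one_lt₀ (by linarith))
    refine h.congr fun Q => ?_
    simp [polyAlphabet, deg, ← pow_mul, mul_comm]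

/-- The constant part `R_q + γ` of the parameter cancels exactly the exponentials in `analyticFactor
F z 1` and `risingLimit z`, at the price of a bounded factor in the error. -/
theorem exists_modPoisson_rate (R : ℝ) :
    ∃ C : ℝ, 0 ≤ C ∧ ∀ w : ℂ, ‖w - 1‖ ≤ R → ∀ n : ℕ, 1 ≤ n →
      ‖(∑ f ∈ monicFinset F n, w ^ numIrreducibleDivisors f) / (Fintype.card F : ℂ) ^ n *
          Complex.exp (-((polyParam (Fintype.card F) n : ℂ) * (w - 1)))
        - bernoulliResidue (polyAlphabet F) (w - 1)‖ ≤ C / n := by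
  obtain ⟨C, hC, hrate⟩ := exists_convolution_rate F R
  set κ := polyR (Fintype.card F) + Real.eulerMascheroniConstant with hκ
  refine ⟨C * Real.exp (R * |κ|), by positivity, fun w hw n hn => ?_⟩
  have h := hrate (w - 1) hw n hn
  rw [sub_add_cancel] at h
  set z := w - 1 with hz
  set G := (∑ f ∈ monicFinset F n, w ^ numIrreducibleDivisors f) / (Fintype.card F : ℂ) ^ n
  have e1 : Complex.exp (-((polyParam (Fintype.card F) n : ℂ) * z))
      = Complex.exp (-(z * (Real.log n : ℝ))) * Complex.exp (-(z * (κ : ℂ))) := by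
    rw [← Complex.exp_add]
    congr 1
    rw [polyParam, hκ]; push_cast; ring
  have e2 : bernoulliResidue (polyAlphabet F) z
      = analyticFactor F z 1 * risingLimit z * Complex.exp (-(z * (κ : ℂ))) := by
    rw [bernoulliResidue_polyAlphabet, analyticFactor, risingLimit, defectSeries_one]
    have : Complex.exp (z * (polyR (Fintype.card F) : ℂ)) *
        Complex.exp (z * (Real.eulerMascheroniConstant : ℂ)) * Complex.exp (-(z * (κ : ℂ))) = 1 := by
      rw [← Complex.exp_add, ← Complex.exp_add, ← Complex.exp_zero]
      congr 1
      rw [hκ]; push_cast; ring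
    linear_combination (- gammaProduct z * primeProduct F z 1) * this
  have e3 : ‖Complex.exp (-(z * (κ : ℂ)))‖ ≤ Real.exp (R * |κ|) := by
    refine norm_exp_le_exp ?_
    rw [norm_neg, norm_mul, Complex.norm_real, Real.norm_eq_abs]
    gcongr
  rw [e1, e2, ← mul_assoc, ← sub_mul, norm_mul]
  calc _ ≤ C / n * Real.exp (R * |κ|) := by gcongr
    _ = _ := by ring

end Residue

/-! ### Expectations under the uniform law on monic polynomials. -/

section Law

theorem integrableOn_count_finset {α : Type*} [MeasurableSpace α] [MeasurableSingletonClass α]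
    (s : Finset α) (g : α → ℂ) : IntegrableOn g s Measure.count := by
  rw [← (s : Set α).biUnion_of_singleton]
  simp [integrableOn_finset_iUnion]

theorem integral_uniformOn_finset {α : Type*} [MeasurableSpace α] [MeasurableSingletonClass α]
    (s : Finset α) (g : α → ℂ) :
    ∫ x, g x ∂(uniformOn (s : Set α)) = (∑ x ∈ s, g x) / s.card := by
  rw [uniformOn, ProbabilityTheory.cond, integral_smul_measure,
    setIntegral_finset _ (integrableOn_count_finset s g)]
  simp [Measure.real, div_eq_inv_mul]

theorem integrable_uniformOn_finset {α : Type*} [MeasurableSpace α] [MeasurableSingletonClass α]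
    (s : Finset α) (g : α → ℂ) : Integrable g (uniformOn (s : Set α)) := by
  rcases s.eq_empty_or_nonempty with rfl | hs
  · simp
  · refine Integrable.smul_measure (integrableOn_count_finset s g) ?_
    simp [hs.ne_empty]

variable {F : Type*} [Field F] [Fintype F] [MeasurableSpace F[X]] [DiscreteMeasurableSpace F[X]]
  {Ω : Type*} [MeasurableSpace Ω] {P : Measure Ω} {f : Ω → F[X]} {n : ℕ}

theorem integral_comp_of_hasLaw_uniformOn_monic
    (hf : HasLaw f (uniformOn {p : F[X] | p.Monic ∧ p.natDegree = n}) P) (g : F[X] → ℂ) :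
    ∫ ω, g (f ω) ∂P = (∑ p ∈ monicFinset F n, g p) / (Fintype.card F : ℂ) ^ n := by
  have hm : StronglyMeasurable g := (Measurable.of_discrete (f := g)).stronglyMeasurable
  have h := hf.integral_comp hm.aestronglyMeasurable
  rw [← coe_monicFinset, integral_uniformOn_finset, card_monicFinset, Nat.cast_pow] at h
  exact h

theorem integrable_comp_of_hasLaw_uniformOn_monic
    (hf : HasLaw f (uniformOn {p : F[X] | p.Monic ∧ p.natDegree = n}) P) (g : F[X] → ℂ) :
    Integrable (fun ω => g (f ω)) P := by
  have hi := integrable_uniformOn_finset (monicFinset F n) g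
  rw [coe_monicFinset, ← hf.map_eq] at hi
  exact hi.comp_aemeasurable hf.aemeasurable

end Law

/-! ### Conclusion. -/

theorem mainTheorem7 {F : Type*} [Field F] [Fintype F]
    [MeasurableSpace F[X]] [DiscreteMeasurableSpace F[X]]
    (q : ℕ) (hq : Fintype.card F = q)
    {Ω : ℕ → Type*} [∀ n, MeasurableSpace (Ω n)]
    (P : ∀ n, Measure (Ω n)) [∀ n, IsProbabilityMeasure (P n)]
    (f : ∀ n, Ω n → F[X])
    (hf : ∀ n, HasLaw (f n) (uniformOn {p : F[X] | p.Monic ∧ p.natDegree = n}) (P n)) :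
    ConvergesModPoissonBernoulli P (fun n ω => numIrreducibleDivisors (f n ω))
      (polyParam q) (polyAlphabet F) ∧
    ∀ K : Set ℂ, IsCompact K → K ⊆ Metric.ball 0 (q : ℝ) →
      ∃ C : ℝ, ∀ n : ℕ, 1 ≤ n → ∀ w ∈ K,
        Integrable (fun ω => w ^ numIrreducibleDivisors (f n ω)) (P n) ∧
        ‖(∫ ω, w ^ numIrreducibleDivisors (f n ω) ∂(P n)) *
              Complex.exp (-((polyParam q n : ℂ) * (w - 1)))
            - bernoulliResidue (polyAlphabet F) (w - 1)‖ ≤ C / n := by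
  subst hq
  have hint : ∀ n (w : ℂ), Integrable (fun ω => w ^ numIrreducibleDivisors (f n ω)) (P n) :=
    fun n w => integrable_comp_of_hasLaw_uniformOn_monic (hf n)
      fun p => w ^ numIrreducibleDivisors p
  -- The rate is uniform on discs of every radius; radius 2 serves for mod-Poisson convergence and
  -- radius `q` for the speed, with no compactness needed.
  have hrate : ∀ R : ℝ, ∃ C : ℝ, 0 ≤ C ∧ ∀ n : ℕ, 1 ≤ n → ∀ w ∈ Metric.ball (0 : ℂ) R,
      ‖(∫ ω, w ^ numIrreducibleDivisors (f n ω) ∂(P n)) *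
            Complex.exp (-((polyParam (Fintype.card F) n : ℂ) * (w - 1)))
          - bernoulliResidue (polyAlphabet F) (w - 1)‖ ≤ C / n := by
    intro R
    obtain ⟨C, hC, h⟩ := exists_modPoisson_rate F (R + 1)
    refine ⟨C, hC, fun n hn w hw => ?_⟩
    rw [integral_comp_of_hasLaw_uniformOn_monic (hf n) fun p => w ^ numIrreducibleDivisors p]
    refine h w ?_ n hn
    have := norm_sub_le w 1
    rw [norm_one] at this
    have := mem_ball_zero_iff.1 hw
    linarith
  refine ⟨⟨fun n => ?_, summable_sq_polyAlphabet F, 2, one_lt_two, fun n w _ => hint n w, ?_⟩, ?_⟩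
  · exact (Measurable.of_discrete (f := (numIrreducibleDivisors : F[X] → ℕ))).comp_aemeasurable
      (hf n).aemeasurable
  · obtain ⟨C, -, h⟩ := hrate 2
    refine TendstoUniformlyOn.tendstoLocallyUniformlyOn ?_
    rw [Metric.tendstoUniformlyOn_iff]
    intro ε hε
    filter_upwards [(tendsto_const_div_atTop_nhds_zero_nat C).eventually_lt_const hε,
      eventually_ge_atTop 1] with n hn hn1 w hw
    rw [dist_comm, dist_eq_norm]
    exact (h n hn1 w hw).trans_lt hn
  · intro K _ hK
    obtain ⟨C, -, h⟩ := hrate (Fintype.card F)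
    exact ⟨C, fun n hn w hw => ⟨hint n w, h n hn w (hK hw)⟩⟩
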